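/- \textbf{Model.} Let $L:[0,\infty)\to[0,\infty)$ be a measurable, physically feasible path loss function, i.e. $L(r)\le L_0:=L(0)$ for all $r\ge 0$ and $\gamma:=\int_0^\infty rL(r)\,dr\in(0,\infty)$, with $L(r)\to L_0$ as $r\downarrow 0$. Let $\sigma^2>0$ be the noise power, and let $N_t:(0,\infty)\to\mathbb N$ be non-decreasing with $N_t(\lambda)\to\infty$ as $\lambda\to\infty$. On one probability space let $\{(x_i,t_i)\}_{i}$ be a Poisson point process on $\mathbb R^2\times[0,\infty)$ with Lebesgue intensity. The base stations at density $\lambda$ are the points of $\Phi_\lambda=\{x_i: t_i\le\lambda\}$, a homogeneous Poisson process of intensity $\lambda$ (this couples all densities by superposition). The user is at the origin and is served by the closest base station, at distance $r_0(\lambda)=\min_{x\in\Phi_\lambda}\|x\|$. All channel coefficients are i.i.d. $\mathcal{CN}(0,1)$ and independent of $\{(x_i,t_i)\}$. For $N$ antennas, $h_0\in\mathbb C^{N}$ is the channel from the serving base station, $h_{i}\in\mathbb C^{N}$ the channel from the interfering base station $i$ to the user, and $h_{i,i}\in\mathbb C^{N}$ the channel from base station $i$ to its own user; each of these vectors consists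 of the first $N$ terms of its own infinite sequence of coefficients. With maximum ratio transmission $p_0=h_0/\|h_0\|$, $p_i=h_{i,i}/\|h_{i,i}\|$ and $N=N_t(\lambda)$, set $$\mathrm{SINR}(\lambda)=\frac{L(r_0(\lambda))\,|h_0^*p_0|^2}{\sum_{i:\,t_i\le\lambda,\ \|x_i\|>r_0(\lambda)}L(\|x_i\|)\,|h_i^*p_i|^2+\sigma^2},\qquad \mathcal E(\lambda)=\lambda\log_2\bigl(1+\mathrm{SINR}(\lambda)\bigr).$$ \textbf{Theorem (MISO case).} Let $\kappa=\frac{L_0}{2\pi\gamma}$. Almost surely, as $\lambda\to\infty$ along the reals, $\mathcal E(\lambda)\to\infty$ and $\mathcal E(\lambda)=\Theta\bigl(\lambda\log(1+N_t(\lambda)/\lambda)\bigr)$. More precisely, almost surely: \begin{enumerate} \item if $\lambda/N_t(\lambda)\to\infty$, then $\mathcal E(\lambda)/N_t(\lambda)\to \kappa/\ln 2$; \item if $\lambda/N_t(\lambda)\to c\in(0,\infty)$, then $\mathcal E(\lambda)/\lambda\to\log_2(1+\kappa/c)$; \item if $\lambda/N_t(\lambda)\to 0$, then $\mathcal E(\lambda)/\bigl(\lambda\log_2(1+N_t(\lambda)/\lambda)\bigr)\to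 1$. \end{enumerate} Suppose in addition that there are $\rho\ge 0$, $\zeta>0$, $\lambda_c\ge0$ and a decreasing differentiable $\tilde L:[\rho,\infty)\to(0,\infty)$ such that $\tilde L\le L$ on $[\rho,\infty)$, $-\zeta\tilde L'(r)\le r\tilde L(r)$ for all $r\ge\rho$, and $\int_\rho^\infty r\,\tilde L(r)^{-2}e^{-\pi\lambda_0r^2}\,dr<\infty$ for all $\lambda_0>\lambda_c$. Then $\mathcal E(\lambda)$ is integrable for every $\lambda>0$, and all the statements above hold with the mean $\mathbb E[\mathcal E(\lambda)]$ in place of $\mathcal E(\lambda)$, with the same limits. -/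

import Mathlib

open Filter Topology MeasureTheory ProbabilityTheory Asymptotics

noncomputable section

/-- Physically feasible path loss functions `L : [0, ∞) → [0, ∞)` (values at negative arguments
are never used): `L` is bounded by `L 0`, and `∫ r L(r) dr` over `(0, ∞)` is finite and
positive. -/
structure PhysicallyFeasible (L : ℝ → ℝ) : Prop where
  measurable : Measurable L
  nonneg : ∀ r, 0 ≤ r → 0 ≤ L r
  le_zero : ∀ r, 0 ≤ r → L r ≤ L 0
  integrable : IntegrableOn (fun r => r * L r) (Set.Ioi 0)
  integral_pos : 0 < ∫ r in Set.Ioi (0 : ℝ), r * L r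

/-- `γ = ∫₀^∞ r L(r) dr`. -/
def pathLossIntegral (L : ℝ → ℝ) : ℝ := ∫ r in Set.Ioi (0 : ℝ), r * L r

/-- The additional regularity assumption on the path loss function: a decreasing differentiable
minorant `L'` on `[ρ, ∞)` with `r L'(r) / (-dL'/dr) ≥ ζ` and with `r L'(r)⁻² exp (-π λ₀ r²)`
integrable over `(ρ, ∞)` for all `λ₀ > λc`.  The quotient condition is cleared of its denominator
(so it holds where the derivative vanishes, the quotient being `+∞` there).  Positivity of the
minorant is forced by the integral condition: a decreasing nonnegative function which vanishes
somewhere vanishes from there on. -/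
def TailAssumption (L : ℝ → ℝ) : Prop :=
  ∃ (ρ ζ lamc : ℝ) (Lt : ℝ → ℝ), 0 ≤ ρ ∧ 0 < ζ ∧ 0 ≤ lamc ∧
    (∀ r ∈ Set.Ici ρ, 0 < Lt r) ∧
    DifferentiableOn ℝ Lt (Set.Ici ρ) ∧
    AntitoneOn Lt (Set.Ici ρ) ∧
    (∀ r ∈ Set.Ici ρ, Lt r ≤ L r) ∧
    (∀ r ∈ Set.Ici ρ, ζ * (-derivWithin Lt (Set.Ici ρ) r) ≤ r * Lt r) ∧
    (∀ lam₀, lamc < lam₀ →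
      IntegrableOn (fun r => r / (Lt r) ^ 2 * Real.exp (-(Real.pi * lam₀ * r ^ 2))) (Set.Ioi ρ))

/-- `ξ` is a Poisson point process with intensity measure `μ`. -/
structure IsPoissonProcess {Ω S : Type*} [MeasurableSpace Ω] [MeasurableSpace S]
    (ξ : Ω → Measure S) (μ : Measure S) (P : Measure Ω) : Prop where
  measurable : Measurable ξ
  poisson : ∀ A : Set S, MeasurableSet A → μ A ≠ ⊤ →
    P.map (fun ω => ξ ω A) =
      (poissonMeasure (μ A).toNNReal).map (fun n : ℕ => (n : ENNReal))
  indep : ∀ (n : ℕ) (A : Fin n → Set S), (∀ i, MeasurableSet (A i)) →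
    Pairwise (fun i j => Disjoint (A i) (A j)) → iIndepFun (fun i ω => ξ ω (A i)) P

/-- The circularly symmetric complex Gaussian law with mean `0` and variance `1`: independent real
and imaginary parts, each of variance `1/2`. -/
def complexGaussian : Measure ℂ :=
  ((gaussianReal 0 (1 / 2)).prod (gaussianReal 0 (1 / 2))).map Complex.measurableEquivRealProd.symm

/-- Labels of the scalar channel coefficients: `serving n` is the coefficient from the `n`-th
antenna of the serving base station to the tagged user, `cross i n` the one from the `n`-th antenna
of the base station `i` (when it interferes) to the tagged user, and `own i n` the one from the
`n`-th antenna of the base station `i` to its own user. -/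
inductive ChannelIndex : Type
  | serving : ℕ → ChannelIndex
  | cross : ℕ → ℕ → ChannelIndex
  | own : ℕ → ℕ → ChannelIndex

/-- The random elements of the network, for all densities at once: base station `i` has the
location `pos i` and the level `level i`, and it is present at density `lam` iff its level is at
most `lam`.  The labels `i` are not ordered by distance. -/
structure Network (Ω : Type*) where
  pos : ℕ → Ω → EuclideanSpace ℝ (Fin 2)
  level : ℕ → Ω → ℝ
  chan : ChannelIndex → Ω → ℂ

/-- The law of the network.  The points `(location, level)` are a Poisson process on
`ℝ² × [0, ∞)` with Lebesgue intensity, so that the base stations present at density `lam` are a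
homogeneous Poisson process of intensity `lam` in the plane, and the ones added between two
densities are an independent homogeneous Poisson process (superposition).  All
channel coefficients are i.i.d. standard complex Gaussian and independent of the points. -/
structure Network.HasModelLaw {Ω : Type*} [MeasurableSpace Ω] (net : Network Ω)
    (P : Measure Ω) : Prop where
  measurable_pos : ∀ i, Measurable (net.pos i)
  measurable_level : ∀ i, Measurable (net.level i)
  measurable_chan : ∀ l, Measurable (net.chan l)
  poisson : IsPoissonProcess
    (fun ω => Measure.sum (fun i => Measure.dirac (net.pos i ω, net.level i ω)))
    ((volume : Measure (EuclideanSpace ℝ (Fin 2))).prod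
      ((volume : Measure ℝ).restrict (Set.Ici 0))) P
  chan_law : ∀ l, P.map (net.chan l) = complexGaussian
  chan_indep : iIndepFun net.chan P
  chan_indep_points : IndepFun (fun ω l => net.chan l ω)
    (fun ω i => (net.pos i ω, net.level i ω)) P

/-- Maximum ratio transmission: the unit precoding vector in the direction of the channel `h`. -/
def mrt {N : ℕ} (h : EuclideanSpace ℂ (Fin N)) : EuclideanSpace ℂ (Fin N) :=
  ((‖h‖⁻¹ : ℝ) : ℂ) • h

/-- The power gain `|h* p|²` of the precoding vector `p` over the channel `h`. -/
def powerGain {N : ℕ} (h p : EuclideanSpace ℂ (Fin N)) : ℝ := ‖inner ℂ h p‖ ^ 2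

namespace Network

variable {Ω : Type*} (net : Network Ω)

/-- The channel vector of the tagged user to its serving base station, with `N` antennas. -/
def servingVec (N : ℕ) (ω : Ω) : EuclideanSpace ℂ (Fin N) :=
  WithLp.toLp 2 (fun n : Fin N => net.chan (.serving n) ω)

/-- The channel vector from the base station `i` to the tagged user, with `N` antennas. -/
def crossVec (N i : ℕ) (ω : Ω) : EuclideanSpace ℂ (Fin N) :=
  WithLp.toLp 2 (fun n : Fin N => net.chan (.cross i n) ω)

/-- The channel vector from the base station `i` to its own user, with `N` antennas. -/
def ownVec (N i : ℕ) (ω : Ω) : EuclideanSpace ℂ (Fin N) :=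
  WithLp.toLp 2 (fun n : Fin N => net.chan (.own i n) ω)

/-- The distance from the origin to the closest base station present at density `lam`. -/
def servingDist (lam : ℝ) (ω : Ω) : ℝ :=
  sInf {d : ℝ | ∃ i, net.level i ω ≤ lam ∧ d = ‖net.pos i ω‖}

/-- The interference power: the sum over the base stations present at density `lam` that are
farther from the origin than the serving one. -/
def interference (L : ℝ → ℝ) (N : ℕ) (lam : ℝ) (ω : Ω) : ℝ :=
  ∑' i : {i : ℕ // net.level i ω ≤ lam ∧ net.servingDist lam ω < ‖net.pos i ω‖},
    L ‖net.pos i ω‖ * powerGain (net.crossVec N i ω) (mrt (net.ownVec N i ω))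

/-- The conditional SINR at density `lam` with `N` transmit antennas and noise power `σ2`. -/
def sinr (L : ℝ → ℝ) (σ2 : ℝ) (N : ℕ) (lam : ℝ) (ω : Ω) : ℝ :=
  L (net.servingDist lam ω) * powerGain (net.servingVec N ω) (mrt (net.servingVec N ω)) /
    (net.interference L N lam ω + σ2)

/-- The conditional area spectral efficiency `λ log₂ (1 + SINR)` with `Nt lam` antennas. -/
def ase (L : ℝ → ℝ) (σ2 : ℝ) (Nt : ℝ → ℕ) (lam : ℝ) (ω : Ω) : ℝ :=
  lam * Real.logb 2 (1 + net.sinr L σ2 (Nt lam) lam ω)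

end Network

/-- The scaling laws of a function `E` of the density, for `Nt` antennas and `κ = L₀ / (2 π γ)`:
`E` grows to infinity and has the exact order `lam * log (1 + Nt lam / lam)`; it is asymptotically
proportional to `Nt`, to `lam`, resp. equivalent to `lam * log₂ (1 + Nt lam / lam)`, if `Nt` scales
sub-linearly, linearly, resp. super-linearly with the density. -/
structure HasScalingLaws (Nt : ℝ → ℕ) (κ : ℝ) (E : ℝ → ℝ) : Prop where
  tendsto_atTop : Tendsto E atTop atTop
  order : E =Θ[atTop] fun lam : ℝ => lam * Real.log (1 + (Nt lam : ℝ) / lam)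
  sublinear : Tendsto (fun lam : ℝ => lam / (Nt lam : ℝ)) atTop atTop →
    Tendsto (fun lam : ℝ => E lam / (Nt lam : ℝ)) atTop (𝓝 (κ / Real.log 2))
  linear : ∀ c : ℝ, 0 < c → Tendsto (fun lam : ℝ => lam / (Nt lam : ℝ)) atTop (𝓝 c) →
    Tendsto (fun lam : ℝ => E lam / lam) atTop (𝓝 (Real.logb 2 (1 + κ / c)))
  superlinear : Tendsto (fun lam : ℝ => lam / (Nt lam : ℝ)) atTop (𝓝 0) →
    Tendsto (fun lam : ℝ => E lam / (lam * Real.logb 2 (1 + (Nt lam : ℝ) / lam))) atTop (𝓝 1)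

end

/-!
Everything follows from one asymptotic equivalence, valid almost surely and in mean and in every
regime of `lam / Nt`:

`ase lam ~ lam * log₂ (1 + κ * Nt lam / lam)`, where `κ = L 0 / (2 π γ)`.

The three scaling regimes, the divergence and the order of growth are then elementary
(`hasScalingLaws_of_tendsto`).

*Numerator.* The nearest base station approaches the user as the density grows, so its path loss
tends to `L 0`, and `‖h₀‖² / N → 1` by the strong law of large numbers.

*Interference.* A precoder is a unit vector which is independent of the channel it multiplies, so
each interfering gain `|hᵢ* pᵢ|²` is, conditionally on the precoder, exponential with mean one.
By the Laplace functional of the Poisson process, the interference at density `lam` has an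
exponential moment of size `exp (θ * lam * (2 π γ + o(1)))` as `θ → 0`, and Chernoff bounds show that
it lies within `lam * (2 π γ ± ε)` up to an event of probability exponentially small in `lam`,
for every fixed number `N` of antennas. The serving base station does not interfere; for the lower
bound it is enough to count the base stations outside of a small disc that contains it. Since `Nt` is an arbitrary function, the estimate is needed for all `N` at
once: the deviation is enlarged by a multiple of `log N`, so that the probabilities are summable
over the integer densities and over `N`, and Borel-Cantelli yields bounds which hold eventually in
`lam` for all `N` simultaneously; monotonicity in the density extends them to real densities.
The term `log N` is harmless: either `log N ≤ √lam` is negligible against `lam`, or `N` is so large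
that both `log (1 + SINR)` and `log (1 + κ * N / lam)` are asymptotic to `log N`
(`tendsto_log_one_add_sinr_ratio`).

*Means.* The ratio of the two sides of the equivalence has bounded second moments
(`Network.HasModelLaw.exists_integral_aseRatio_sq_le`): the SINR is at most of the order `N / lam`
times `‖h₀‖² / N` unless the interference is much smaller than `lam`, and on that exponentially
unlikely event the noise bounds the SINR. Almost sure convergence therefore gives convergence of
means.
-/

noncomputable section

open scoped RealInnerProductSpace ComplexConjugate

/-! ### The complex Gaussian law -/

instance : IsProbabilityMeasure complexGaussian :=
  Measure.isProbabilityMeasure_map Complex.measurableEquivRealProd.symm.measurable.aemeasurable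

theorem charFun_complexGaussian (t : ℂ) :
    charFun complexGaussian t = Complex.exp (-(‖t‖ ^ 2 / 4 : ℝ)) := by
  rw [charFun_apply, complexGaussian, integral_map_equiv]
  have h : ∀ x : ℝ × ℝ, Complex.exp (((⟪Complex.measurableEquivRealProd.symm x, t⟫ : ℝ) : ℂ)
      * Complex.I) = Complex.exp ((t.re * x.1 : ℂ) * Complex.I)
        * Complex.exp ((t.im * x.2 : ℂ) * Complex.I) := by
    intro x
    rw [← Complex.exp_add, Complex.inner]
    congr 1
    simp [Complex.measurableEquivRealProd]
    ring
  simp_rw [h]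
  rw [integral_prod_mul (f := fun x : ℝ => Complex.exp ((t.re * x : ℂ) * Complex.I))
    (g := fun x : ℝ => Complex.exp ((t.im * x : ℂ) * Complex.I)),
    ← charFun_apply_real, ← charFun_apply_real, charFun_gaussianReal, charFun_gaussianReal,
    ← Complex.exp_add]
  congr 1
  rw [← Complex.normSq_eq_norm_sq, Complex.normSq_apply]
  push_cast
  ring

/-- The squared modulus of a standard complex Gaussian is exponentially distributed with mean
`1`. -/
theorem lintegral_exp_normSq_complexGaussian {s : ℝ} (hs : s < 1) :
    ∫⁻ z, ENNReal.ofReal (Real.exp (s * ‖z‖ ^ 2)) ∂complexGaussian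
      = ENNReal.ofReal (1 / (1 - s)) := by
  have h1 : ∫⁻ x, ENNReal.ofReal (Real.exp (s * x ^ 2)) ∂(gaussianReal 0 (1 / 2))
      = ENNReal.ofReal (Real.sqrt (1 / (1 - s))) := by
    rw [gaussianReal_of_var_ne_zero _ (by norm_num),
      lintegral_withDensity_eq_lintegral_mul _ (measurable_gaussianPDF _ _) (by fun_prop)]
    have h2 : ∀ x : ℝ, (gaussianPDF 0 (1 / 2) * fun x => ENNReal.ofReal (Real.exp (s * x ^ 2))) x
        = ENNReal.ofReal ((Real.sqrt Real.pi)⁻¹ * Real.exp (-(1 - s) * x ^ 2)) := by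
      intro x
      rw [Pi.mul_apply, gaussianPDF, ← ENNReal.ofReal_mul (gaussianPDFReal_nonneg _ _ _),
        gaussianPDFReal]
      congr 1
      rw [mul_assoc, ← Real.exp_add]
      congr 2
      · congr 1; push_cast; ring
      · push_cast; ring
    simp_rw [h2]
    rw [← ofReal_integral_eq_lintegral_ofReal]
    · rw [integral_const_mul, integral_gaussian, Real.sqrt_div Real.pi_pos.le,
        Real.sqrt_div zero_le_one, Real.sqrt_one]
      congr 1
      have := Real.sqrt_pos.2 Real.pi_pos
      field_simp
    · exact (integrable_exp_neg_mul_sq (by linarith)).const_mul _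
    · exact ae_of_all _ fun x => by positivity
  rw [complexGaussian, lintegral_map_equiv]
  have h : ∀ x : ℝ × ℝ, ENNReal.ofReal
      (Real.exp (s * ‖Complex.measurableEquivRealProd.symm x‖ ^ 2))
      = ENNReal.ofReal (Real.exp (s * x.1 ^ 2)) * ENNReal.ofReal (Real.exp (s * x.2 ^ 2)) := by
    intro x
    rw [← ENNReal.ofReal_mul (by positivity), ← Real.exp_add, ← Complex.normSq_eq_norm_sq,
      Complex.normSq_apply]
    congr 2
    simp [Complex.measurableEquivRealProd]
    ring
  simp_rw [h]
  rw [lintegral_prod_mul (f := fun x : ℝ => ENNReal.ofReal (Real.exp (s * x ^ 2)))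
    (g := fun x : ℝ => ENNReal.ofReal (Real.exp (s * x ^ 2))) (by fun_prop) (by fun_prop), h1,
    ← ENNReal.ofReal_mul (by positivity), Real.mul_self_sqrt]
  exact one_div_nonneg.2 (by linarith)

theorem complexGaussian_singleton_zero : complexGaussian {0} = 0 := by
  rw [complexGaussian, Measure.map_apply Complex.measurableEquivRealProd.symm.measurable
    (measurableSet_singleton 0)]
  have h : Complex.measurableEquivRealProd.symm ⁻¹' {0} ⊆ ({0} : Set ℝ) ×ˢ Set.univ := by
    intro x hx
    have := congrArg Complex.re (Set.mem_singleton_iff.1 hx)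
    simpa [Complex.measurableEquivRealProd] using this
  refine measure_mono_null h ?_
  have := nullSingletonClass_gaussianReal (μ := 0) (v := 1 / 2) (by norm_num)
  rw [Measure.prod_prod, measure_singleton, zero_mul]

theorem integral_normSq_complexGaussian : ∫ z, ‖z‖ ^ 2 ∂complexGaussian = 1 := by
  have hi : Integrable (fun x : ℝ => x ^ 2) (gaussianReal 0 (1 / 2)) :=
    (memLp_id_gaussianReal (μ := 0) (v := 1 / 2) 2).integrable_sq
  have hv : ∫ x : ℝ, x ^ 2 ∂(gaussianReal 0 (1 / 2)) = 1 / 2 := by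
    have := variance_id_gaussianReal (μ := 0) (v := 1 / 2)
    rw [variance_of_integral_eq_zero aemeasurable_id (by simp)] at this
    simpa using this
  rw [complexGaussian, integral_map_equiv]
  have h : ∀ x : ℝ × ℝ, ‖Complex.measurableEquivRealProd.symm x‖ ^ 2 = x.1 ^ 2 + x.2 ^ 2 := by
    intro x
    rw [← Complex.normSq_eq_norm_sq, Complex.normSq_apply]
    simp [Complex.measurableEquivRealProd]
    ring
  simp_rw [h]
  rw [integral_add (hi.comp_fst _) (hi.comp_snd _),
    integral_fun_fst (f := fun x : ℝ => x ^ 2), integral_fun_snd (f := fun x : ℝ => x ^ 2)]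
  simp only [hv]
  simp
  norm_num

theorem charFun_map_mul_conj_complexGaussian (u t : ℂ) :
    charFun (complexGaussian.map fun z => conj z * u) t
      = Complex.exp (-(‖u‖ ^ 2 * ‖t‖ ^ 2 / 4 : ℝ)) := by
  have h : charFun (complexGaussian.map fun z => conj z * u) t
      = charFun complexGaussian (u * conj t) := by
    rw [charFun_apply, charFun_apply, integral_map (by fun_prop) (by fun_prop)]
    congr 1 with z
    rw [Complex.inner, Complex.inner]
    congr 3
    rw [map_mul, ← Complex.conj_re]
    simp only [map_mul, Complex.conj_conj]
    congr 1
    ring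
  rw [h, charFun_complexGaussian, norm_mul, RCLike.norm_conj, mul_pow]

/-- The inner product of a vector of independent standard complex Gaussians with a unit vector
is again a standard complex Gaussian. -/
theorem map_inner_eq_complexGaussian {Ω : Type*} [MeasurableSpace Ω] {P : Measure Ω}
    [IsProbabilityMeasure P] {N : ℕ} {X : Fin N → Ω → ℂ} (hX : ∀ n, Measurable (X n))
    (hlaw : ∀ n, P.map (X n) = complexGaussian) (hind : iIndepFun X P)
    (u : EuclideanSpace ℂ (Fin N)) (hu : ‖u‖ = 1) :
    P.map (fun ω => inner ℂ (WithLp.toLp 2 fun n => X n ω) u) = complexGaussian := by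
  have hinner : (fun ω => inner ℂ (WithLp.toLp 2 fun n => X n ω) u)
      = fun ω => ∑ n, conj (X n ω) * u n := by
    funext ω
    simp [PiLp.inner_apply, mul_comm]
  rw [hinner]
  have hm : ∀ n, Measurable fun ω => conj (X n ω) * u n := fun n => by
    have := hX n
    fun_prop
  have : IsProbabilityMeasure (P.map fun ω => ∑ n, conj (X n ω) * u n) :=
    Measure.isProbabilityMeasure_map (Finset.measurable_fun_sum _ fun n _ => hm n).aemeasurable
  refine Measure.ext_of_charFun ?_
  have hind' : iIndepFun (fun n ω => conj (X n ω) * u n) P :=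
    hind.comp (fun n z => conj z * u n) fun n => by fun_prop
  rw [iIndepFun.charFun_map_fun_sum_eq_prod (fun n => (hm n).aemeasurable) hind']
  funext t
  have hn : ∀ n, charFun (P.map fun ω => conj (X n ω) * u n) t
      = Complex.exp (-(‖u n‖ ^ 2 * ‖t‖ ^ 2 / 4 : ℝ)) := by
    intro n
    rw [← charFun_map_mul_conj_complexGaussian, ← hlaw n, Measure.map_map (by fun_prop) (hX n)]
    rfl
  rw [Finset.prod_apply, Finset.prod_congr rfl fun n _ => hn n, ← Complex.exp_sum,
    charFun_complexGaussian]
  congr 1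
  rw [Finset.sum_neg_distrib, ← Complex.ofReal_sum, ← Finset.sum_div, ← Finset.sum_mul,
    ← EuclideanSpace.norm_sq_eq, hu]
  simp

/-! ### Gains of the interfering channels -/

/-- The power gain of the interfering base station `i` with `N` antennas, as a function of all
channel coefficients. -/
def interferenceGain (N i : ℕ) (c : ChannelIndex → ℂ) : ℝ :=
  powerGain (WithLp.toLp 2 fun n : Fin N => c (.cross i n))
    (mrt (WithLp.toLp 2 fun n : Fin N => c (.own i n)))

theorem interferenceGain_nonneg (N i : ℕ) (c : ChannelIndex → ℂ) :
    0 ≤ interferenceGain N i c := sq_nonneg _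

theorem measurable_powerGain_mrt (N : ℕ) :
    Measurable fun p : (Fin N → ℂ) × (Fin N → ℂ) =>
      powerGain (WithLp.toLp 2 p.1) (mrt (WithLp.toLp 2 p.2)) := by
  have h1 : Measurable fun p : (Fin N → ℂ) × (Fin N → ℂ) =>
      (WithLp.toLp 2 p.1 : EuclideanSpace ℂ (Fin N)) :=
    (WithLp.measurable_toLp 2 (Fin N → ℂ)).comp measurable_fst
  have h2 : Measurable fun p : (Fin N → ℂ) × (Fin N → ℂ) =>
      (WithLp.toLp 2 p.2 : EuclideanSpace ℂ (Fin N)) :=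
    (WithLp.measurable_toLp 2 (Fin N → ℂ)).comp measurable_snd
  unfold powerGain mrt
  exact ((h1.inner ((Complex.measurable_ofReal.comp h2.norm.inv).smul h2)).norm).pow_const 2

section Channels

variable {Ω : Type*}

theorem measurable_interferenceGain [MeasurableSpace Ω] {X : ChannelIndex → Ω → ℂ} {N i : ℕ}
    (hc : ∀ n, Measurable (X (.cross i n))) (ho : ∀ n, Measurable (X (.own i n))) :
    Measurable fun ω => interferenceGain N i fun l => X l ω := by
  have h : Measurable fun ω =>
      ((fun n : Fin N => X (.cross i n) ω, fun n : Fin N => X (.own i n) ω) :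
        (Fin N → ℂ) × (Fin N → ℂ)) :=
    (measurable_pi_lambda _ fun n : Fin N => hc n).prodMk
      (measurable_pi_lambda _ fun n : Fin N => ho n)
  have h' := (measurable_powerGain_mrt N).comp h
  unfold interferenceGain
  exact h'

/-- The σ-algebra generated by the members of the family `X` with labels in `S`. -/
abbrev sigmaGenerated {ι : Type*} (X : ι → Ω → ℂ) (S : Set ι) : MeasurableSpace Ω :=
  ⨆ l ∈ S, MeasurableSpace.comap (X l) inferInstance

theorem measurable_sigmaGenerated {ι : Type*} (X : ι → Ω → ℂ) {S : Set ι} {l : ι} (hl : l ∈ S) :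
    Measurable[sigmaGenerated X S] (X l) :=
  (comap_measurable (X l)).mono (le_biSup (fun l => MeasurableSpace.comap (X l) _) hl) le_rfl

variable [MeasurableSpace Ω] {P : Measure Ω} {X : ChannelIndex → Ω → ℂ}

theorem sigmaGenerated_le {ι : Type*} {X : ι → Ω → ℂ} (hm : ∀ l, Measurable (X l)) (S : Set ι) :
    sigmaGenerated X S ≤ ‹MeasurableSpace Ω› :=
  iSup₂_le fun l _ => (hm l).comap_le

theorem indep_sigmaGenerated {ι : Type*} {X : ι → Ω → ℂ} (hm : ∀ l, Measurable (X l))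
    (hind : iIndepFun X P) {S T : Set ι} (hST : Disjoint S T) :
    Indep (sigmaGenerated X S) (sigmaGenerated X T) P :=
  indep_iSup_of_disjoint (fun l => (hm l).comap_le) ((iIndepFun_iff_iIndep _ _ _).1 hind) hST

/-- The gains of distinct interferers depend on disjoint sets of coefficients, so that the
expectation of a product factorizes. -/
theorem lintegral_prod_interferenceGain [IsProbabilityMeasure P] (hm : ∀ l, Measurable (X l))
    (hind : iIndepFun X P) (N : ℕ) {F : ℕ → ℝ → ENNReal} (hF : ∀ i, Measurable (F i)) (M : ℕ) :
    ∫⁻ ω, ∏ i ∈ Finset.range M, F i (interferenceGain N i fun l => X l ω) ∂P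
      = ∏ i ∈ Finset.range M, ∫⁻ ω, F i (interferenceGain N i fun l => X l ω) ∂P := by
  induction M with
  | zero => simp
  | succ M ih =>
    simp_rw [Finset.prod_range_succ]
    rw [← ih]
    let S : Set ChannelIndex := {l | ∃ i < M, ∃ n, l = .cross i n ∨ l = .own i n}
    let T : Set ChannelIndex := {l | ∃ n, l = .cross M n ∨ l = .own M n}
    have hST : Disjoint S T := by
      rw [Set.disjoint_left]
      rintro l ⟨i, hi, n, rfl | rfl⟩ ⟨k, hk | hk⟩ <;> simp at hk <;> omega
    refine lintegral_mul_eq_lintegral_mul_lintegral_of_independent_measurableSpace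
      (sigmaGenerated_le hm S) (sigmaGenerated_le hm T) (indep_sigmaGenerated hm hind hST) ?_ ?_
    · refine Finset.measurable_fun_prod _ fun i hi => (hF i).comp ?_
      exact @measurable_interferenceGain Ω (sigmaGenerated X S) X N i
        (fun n => measurable_sigmaGenerated X ⟨i, Finset.mem_range.1 hi, n, .inl rfl⟩)
        (fun n => measurable_sigmaGenerated X ⟨i, Finset.mem_range.1 hi, n, .inr rfl⟩)
    · refine (hF M).comp ?_
      exact @measurable_interferenceGain Ω (sigmaGenerated X T) X N M
        (fun n => measurable_sigmaGenerated X ⟨n, .inl rfl⟩)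
        (fun n => measurable_sigmaGenerated X ⟨n, .inr rfl⟩)

/-- Conditionally on the precoder, a gain is the squared modulus of a standard complex Gaussian. -/
theorem lintegral_exp_interferenceGain [IsProbabilityMeasure P] (hm : ∀ l, Measurable (X l))
    (hlaw : ∀ l, P.map (X l) = complexGaussian) (hind : iIndepFun X P) {N : ℕ} (hN : 1 ≤ N)
    (i : ℕ) {s : ℝ} (hs : s < 1) :
    ∫⁻ ω, ENNReal.ofReal (Real.exp (s * interferenceGain N i fun l => X l ω)) ∂P
      = ENNReal.ofReal (1 / (1 - s)) := by
  let Xc : Ω → Fin N → ℂ := fun ω n => X (.cross i n) ω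
  let Xo : Ω → Fin N → ℂ := fun ω n => X (.own i n) ω
  have hXc : Measurable Xc := measurable_pi_lambda _ fun n => hm _
  have hXo : Measurable Xo := measurable_pi_lambda _ fun n => hm _
  have hco : IndepFun Xc Xo P := by
    have hST : Disjoint (Set.range (ChannelIndex.cross i)) (Set.range (ChannelIndex.own i)) := by
      rw [Set.disjoint_left]
      rintro l ⟨n, rfl⟩ ⟨k, hk⟩
      simp at hk
    have h := indep_sigmaGenerated hm hind hST
    rw [IndepFun_iff_Indep]
    refine indep_of_indep_of_le_left (indep_of_indep_of_le_right h ?_) ?_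
    · exact Measurable.comap_le (@measurable_pi_lambda _ _ _ (sigmaGenerated X _) _ _
        fun n => measurable_sigmaGenerated X ⟨n, rfl⟩)
    · exact Measurable.comap_le (@measurable_pi_lambda _ _ _ (sigmaGenerated X _) _ _
        fun n => measurable_sigmaGenerated X ⟨n, rfl⟩)
  let F : (Fin N → ℂ) × (Fin N → ℂ) → ENNReal := fun p => ENNReal.ofReal
    (Real.exp (s * powerGain (WithLp.toLp 2 p.1) (mrt (WithLp.toLp 2 p.2))))
  have hF : Measurable F :=
    (Real.measurable_exp.comp ((measurable_powerGain_mrt N).const_mul s)).ennreal_ofReal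
  have : IsProbabilityMeasure (P.map Xc) := Measure.isProbabilityMeasure_map hXc.aemeasurable
  have : IsProbabilityMeasure (P.map Xo) := Measure.isProbabilityMeasure_map hXo.aemeasurable
  calc ∫⁻ ω, ENNReal.ofReal (Real.exp (s * interferenceGain N i fun l => X l ω)) ∂P
      = ∫⁻ p, F p ∂(P.map fun ω => (Xc ω, Xo ω)) := by
        rw [lintegral_map hF (hXc.prodMk hXo)]
        rfl
    _ = ∫⁻ o, ∫⁻ c, F (c, o) ∂(P.map Xc) ∂(P.map Xo) := by
        rw [(indepFun_iff_map_prod_eq_prod_map_map hXc.aemeasurable hXo.aemeasurable).1 hco,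
          lintegral_prod_symm _ hF.aemeasurable]
    _ = ∫⁻ _, ENNReal.ofReal (1 / (1 - s)) ∂(P.map Xo) := by
        refine lintegral_congr_ae ?_
        have h0 : ∀ᵐ o ∂(P.map Xo), o ⟨0, hN⟩ ≠ 0 := by
          have hms : MeasurableSet {o : Fin N → ℂ | o ⟨0, hN⟩ ≠ 0} :=
            (measurableSet_singleton (0 : ℂ)).compl.preimage (measurable_pi_apply _)
          rw [ae_map_iff hXo.aemeasurable hms]
          have h1 : ∀ᵐ z ∂(P.map (X (.own i 0))), z ≠ 0 := by
            rw [hlaw]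
            exact measure_eq_zero_iff_ae_notMem.1 complexGaussian_singleton_zero
          exact ae_of_ae_map (hm _).aemeasurable h1
        filter_upwards [h0] with o ho
        have hne : (WithLp.toLp 2 o : EuclideanSpace ℂ (Fin N)) ≠ 0 := fun h =>
          ho (congrArg (fun v : EuclideanSpace ℂ (Fin N) => v ⟨0, hN⟩) h)
        have hu : ‖mrt (WithLp.toLp 2 o : EuclideanSpace ℂ (Fin N))‖ = 1 := by
          rw [mrt, norm_smul, Complex.norm_real, norm_inv, norm_norm,
            inv_mul_cancel₀ (norm_ne_zero_iff.2 hne)]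
        have hFo : Measurable fun c => F (c, o) := hF.comp measurable_prodMk_right
        rw [lintegral_map hFo hXc, ← lintegral_exp_normSq_complexGaussian hs,
          ← map_inner_eq_complexGaussian (P := P) (X := fun (n : Fin N) => X (.cross i n))
            (fun n => hm _) (fun n => hlaw _)
            (hind.precomp (g := fun n : Fin N => ChannelIndex.cross i n)
              fun a b hab => by simpa [Fin.ext_iff] using hab) _ hu, lintegral_map]
        · rfl
        · fun_prop
        · exact ((WithLp.measurable_toLp 2 (Fin N → ℂ)).comp hXc).inner measurable_const
    _ = ENNReal.ofReal (1 / (1 - s)) := by simp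

theorem inv_one_sub_le_exp {s : ℝ} (hs : |s| ≤ 1 / 2) : 1 / (1 - s) ≤ Real.exp (s + s ^ 2) := by
  obtain ⟨h1, h2⟩ := abs_le.1 hs
  rw [div_le_iff₀ (by linarith)]
  rcases le_total 0 s with h | h
  · have h3 := Real.quadratic_le_exp_of_nonneg (x := s + s ^ 2) (by positivity)
    have h4 : 1 ≤ (1 + (s + s ^ 2) + (s + s ^ 2) ^ 2 / 2) * (1 - s) := by
      nlinarith [mul_nonneg (sq_nonneg s) h, mul_nonneg (sq_nonneg s) (by linarith : 0 ≤ 1 / 2 - s),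
        mul_nonneg (mul_nonneg (sq_nonneg s) h) (by linarith : 0 ≤ 1 / 2 - s),
        mul_nonneg (mul_nonneg (sq_nonneg s) (sq_nonneg s)) (by linarith : 0 ≤ 1 / 2 - s)]
    nlinarith
  · have h3 := Real.add_one_le_exp (s + s ^ 2)
    have h4 : 0 ≤ -s * s ^ 2 := mul_nonneg (by linarith) (sq_nonneg s)
    nlinarith

theorem measurable_interferenceGain_apply (N i : ℕ) :
    Measurable fun c => interferenceGain N i c := by
  have hc : ∀ n, Measurable fun c : ChannelIndex → ℂ => c (.cross i n) :=
    fun n => measurable_pi_apply (ChannelIndex.cross i n)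
  have ho : ∀ n, Measurable fun c : ChannelIndex → ℂ => c (.own i n) :=
    fun n => measurable_pi_apply (ChannelIndex.own i n)
  exact measurable_interferenceGain (X := fun l (c : ChannelIndex → ℂ) => c l) (N := N) hc ho

/-- Conditionally on the points, the exponential moment of a weighted sum of gains is bounded by
that of a function of the points. -/
theorem lintegral_exp_sum_interferenceGain_le [IsProbabilityMeasure P]
    (hm : ∀ l, Measurable (X l)) (hlaw : ∀ l, P.map (X l) = complexGaussian)
    (hind : iIndepFun X P) {N : ℕ} (hN : 1 ≤ N) {S : Type*} [MeasurableSpace S]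
    {V : ℕ → Ω → S} (hV : ∀ i, Measurable (V i))
    (hXV : IndepFun (fun ω l => X l ω) (fun ω i => V i ω) P)
    {s : S → ℝ} (hs : Measurable s) (hs' : ∀ x, |s x| ≤ 1 / 2) (M : ℕ) :
    ∫⁻ ω, ENNReal.ofReal (Real.exp (∑ i ∈ Finset.range M,
        s (V i ω) * interferenceGain N i fun l => X l ω)) ∂P
      ≤ ∫⁻ ω, ENNReal.ofReal (Real.exp (∑ i ∈ Finset.range M,
        (s (V i ω) + s (V i ω) ^ 2))) ∂P := by
  let C : Ω → ChannelIndex → ℂ := fun ω l => X l ω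
  let W : Ω → ℕ → S := fun ω i => V i ω
  have hC : Measurable C := measurable_pi_lambda _ hm
  have hW : Measurable W := measurable_pi_lambda _ hV
  let F : (ChannelIndex → ℂ) × (ℕ → S) → ENNReal := fun p => ENNReal.ofReal
    (Real.exp (∑ i ∈ Finset.range M, s (p.2 i) * interferenceGain N i p.1))
  have hF : Measurable F := by
    have h : Measurable fun p : (ChannelIndex → ℂ) × (ℕ → S) =>
        ∑ i ∈ Finset.range M, s (p.2 i) * interferenceGain N i p.1 :=
      Finset.measurable_fun_sum _ fun i _ =>
        (hs.comp ((measurable_pi_apply i).comp measurable_snd)).mul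
          ((measurable_interferenceGain_apply N i).comp measurable_fst)
    exact h.exp.ennreal_ofReal
  have : IsProbabilityMeasure (P.map C) := Measure.isProbabilityMeasure_map hC.aemeasurable
  have : IsProbabilityMeasure (P.map W) := Measure.isProbabilityMeasure_map hW.aemeasurable
  calc ∫⁻ ω, ENNReal.ofReal (Real.exp (∑ i ∈ Finset.range M,
        s (V i ω) * interferenceGain N i fun l => X l ω)) ∂P
      = ∫⁻ p, F p ∂(P.map fun ω => (C ω, W ω)) := by
        rw [lintegral_map hF (hC.prodMk hW)]
    _ = ∫⁻ v, ∫⁻ c, F (c, v) ∂(P.map C) ∂(P.map W) := by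
        rw [(indepFun_iff_map_prod_eq_prod_map_map hC.aemeasurable hW.aemeasurable).1 hXV,
          lintegral_prod_symm _ hF.aemeasurable]
    _ ≤ ∫⁻ v, ENNReal.ofReal (Real.exp (∑ i ∈ Finset.range M,
          (s (v i) + s (v i) ^ 2))) ∂(P.map W) := by
        refine lintegral_mono fun v => ?_
        have hFv : Measurable fun c => F (c, v) := hF.comp measurable_prodMk_right
        rw [lintegral_map hFv hC]
        have h1 : ∀ ω, F (C ω, v) = ∏ i ∈ Finset.range M, ENNReal.ofReal
            (Real.exp (s (v i) * interferenceGain N i fun l => X l ω)) := by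
          intro ω
          rw [← ENNReal.ofReal_prod_of_nonneg fun i _ => (Real.exp_pos _).le, ← Real.exp_sum]
        simp_rw [h1]
        rw [lintegral_prod_interferenceGain hm hind N
          (F := fun i g => ENNReal.ofReal (Real.exp (s (v i) * g))) (fun i => by fun_prop),
          Real.exp_sum, ENNReal.ofReal_prod_of_nonneg fun i _ => (Real.exp_pos _).le]
        refine Finset.prod_le_prod' fun i _ => ?_
        rw [lintegral_exp_interferenceGain hm hlaw hind hN i
          (lt_of_le_of_lt ((le_abs_self _).trans (hs' (v i))) (by norm_num))]
        exact ENNReal.ofReal_le_ofReal (inv_one_sub_le_exp (hs' _))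
    _ = _ := by
        have h : Measurable fun v : ℕ → S => ∑ i ∈ Finset.range M, (s (v i) + s (v i) ^ 2) :=
          Finset.measurable_fun_sum _ fun i _ => by
            have : Measurable fun v : ℕ → S => s (v i) := hs.comp (measurable_pi_apply i)
            exact this.add (this.pow_const 2)
        rw [lintegral_map h.exp.ennreal_ofReal hW]

end Channels

/-! ### Exponential moments of Poisson processes -/

section Poisson

variable {Ω S : Type*} [MeasurableSpace Ω] [MeasurableSpace S] {P : Measure Ω} {μ : Measure S}

theorem lintegral_exp_mul_poissonMeasure (r : NNReal) (c : ℝ) :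
    ∫⁻ n, ENNReal.ofReal (Real.exp (c * (n : ℝ))) ∂(poissonMeasure r)
      = ENNReal.ofReal (Real.exp (r * (Real.exp c - 1))) := by
  rw [poissonMeasure, lintegral_sum_measure]
  simp_rw [lintegral_smul_measure, lintegral_dirac, smul_eq_mul]
  have h1 : ∀ n : ℕ, ENNReal.ofReal (Real.exp (-r) * r ^ n / n.factorial)
      * ENNReal.ofReal (Real.exp (c * n)) = ENNReal.ofReal
      (Real.exp (-r) * ((r * Real.exp c) ^ n / n.factorial)) := by
    intro n
    rw [← ENNReal.ofReal_mul (by positivity), mul_comm c, Real.exp_nat_mul, mul_pow]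
    congr 1
    ring
  have h2 : HasSum (fun n : ℕ => Real.exp (-r) * ((r * Real.exp c) ^ n / n.factorial))
      (Real.exp (r * (Real.exp c - 1))) := by
    have := (NormedSpace.expSeries_div_hasSum_exp (r * Real.exp c)).mul_left (Real.exp (-r))
    rw [← Real.exp_eq_exp_ℝ, ← Real.exp_add] at this
    rwa [show (r : ℝ) * (Real.exp c - 1) = -r + r * Real.exp c by ring]
  simp_rw [h1]
  rw [← ENNReal.ofReal_tsum_of_nonneg (fun n => by positivity) h2.summable, h2.tsum_eq]

theorem measurable_apply_of_isPoissonProcess {ξ : Ω → Measure S} (hξ : IsPoissonProcess ξ μ P)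
    {A : Set S} (hA : MeasurableSet A) : Measurable fun ω => ξ ω A :=
  (Measure.measurable_coe hA).comp hξ.measurable

theorem ae_lt_top_of_isPoissonProcess {ξ : Ω → Measure S} (hξ : IsPoissonProcess ξ μ P)
    {A : Set S} (hA : MeasurableSet A) (hμA : μ A ≠ ⊤) : ∀ᵐ ω ∂P, ξ ω A < ⊤ := by
  have h : ∀ᵐ x ∂(P.map fun ω => ξ ω A), x < ⊤ := by
    rw [hξ.poisson A hA hμA, ae_map_iff (by fun_prop) measurableSet_Iio]
    exact ae_of_all _ fun n => ENNReal.natCast_lt_top n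
  exact ae_of_ae_map (measurable_apply_of_isPoissonProcess hξ hA).aemeasurable h

theorem lintegral_exp_mul_of_isPoissonProcess {ξ : Ω → Measure S} (hξ : IsPoissonProcess ξ μ P)
    {A : Set S} (hA : MeasurableSet A) (hμA : μ A ≠ ⊤) (c : ℝ) :
    ∫⁻ ω, ENNReal.ofReal (Real.exp (c * (ξ ω A).toReal)) ∂P
      = ENNReal.ofReal (Real.exp (μ.real A * (Real.exp c - 1))) := by
  have h1 : ∫⁻ ω, ENNReal.ofReal (Real.exp (c * (ξ ω A).toReal)) ∂P
      = ∫⁻ x, ENNReal.ofReal (Real.exp (c * x.toReal)) ∂(P.map fun ω => ξ ω A) := by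
    rw [lintegral_map (by fun_prop) (measurable_apply_of_isPoissonProcess hξ hA)]
  rw [h1, hξ.poisson A hA hμA, lintegral_map (by fun_prop) (by fun_prop)]
  simp_rw [ENNReal.toReal_natCast]
  rw [lintegral_exp_mul_poissonMeasure]
  rfl

theorem lintegral_exp_sum_of_isPoissonProcess [IsProbabilityMeasure P] {ξ : Ω → Measure S}
    (hξ : IsPoissonProcess ξ μ P) {n : ℕ} {A : Fin n → Set S} (hA : ∀ i, MeasurableSet (A i))
    (hdisj : Pairwise fun i j => Disjoint (A i) (A j)) (hμA : ∀ i, μ (A i) ≠ ⊤) (c : Fin n → ℝ) :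
    ∫⁻ ω, ENNReal.ofReal (Real.exp (∑ i, c i * (ξ ω (A i)).toReal)) ∂P
      = ENNReal.ofReal (Real.exp (∑ i, μ.real (A i) * (Real.exp (c i) - 1))) := by
  simp_rw [Real.exp_sum, ENNReal.ofReal_prod_of_nonneg fun i _ => (Real.exp_pos _).le]
  rw [lintegral_prod_eq_prod_lintegral_of_indepFun Finset.univ
    (fun i ω => ENNReal.ofReal (Real.exp (c i * (ξ ω (A i)).toReal)))]
  · exact Finset.prod_congr rfl fun i _ =>
      lintegral_exp_mul_of_isPoissonProcess hξ (hA i) (hμA i) (c i)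
  · exact (hξ.indep n A hA hdisj).comp
      (fun i x => ENNReal.ofReal (Real.exp (c i * x.toReal))) fun i => by fun_prop
  · intro i
    have := measurable_apply_of_isPoissonProcess hξ (hA i)
    fun_prop

/-- The integral of a simple function with respect to a counting measure `ξ`, with the value zero
left out. -/
def simpleIntegral (f : SimpleFunc S ℝ) (ξ : Measure S) : ℝ :=
  ∑ y ∈ f.range with y ≠ 0, y * (ξ (f ⁻¹' {y})).toReal

/-- The Laplace functional of a Poisson process, for simple functions. -/
theorem lintegral_exp_simpleIntegral [IsProbabilityMeasure P] {ξ : Ω → Measure S}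
    (hξ : IsPoissonProcess ξ μ P) {f : SimpleFunc S ℝ} (hf : Integrable f μ) :
    ∫⁻ ω, ENNReal.ofReal (Real.exp (simpleIntegral f (ξ ω))) ∂P
      = ENNReal.ofReal (Real.exp (∫ x, (Real.exp (f x) - 1) ∂μ)) := by
  have hfin : ∀ y ≠ 0, μ (f ⁻¹' {y}) ≠ ⊤ := fun y hy =>
    ((SimpleFunc.integrable_iff.1 hf) y hy).ne
  let s : Finset ℝ := f.range.filter (· ≠ 0)
  let e := s.equivFin
  have hsum : ∀ g : ℝ → ℝ, ∑ k, g (e.symm k) = ∑ y ∈ s, g y := fun g => by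
    rw [Equiv.sum_comp e.symm fun y : s => g y, Finset.sum_coe_sort]
  have h1 : ∫ x, (Real.exp (f x) - 1) ∂μ = ∑ y ∈ s, μ.real (f ⁻¹' {y}) * (Real.exp y - 1) := by
    have hint : Integrable (f.map fun y => Real.exp y - 1) μ := by
      rw [SimpleFunc.integrable_iff_finMeasSupp] at hf ⊢
      exact hf.map (by simp)
    have h2 := SimpleFunc.integral_eq_integral _ hint
    rw [SimpleFunc.map_integral f _ hf (by simp)] at h2
    simp only [SimpleFunc.coe_map, Function.comp_def] at h2
    rw [← h2, Finset.sum_filter]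
    refine Finset.sum_congr rfl fun y _ => ?_
    by_cases hy : y = 0 <;> simp [hy]
  have h3 : ∀ ω, simpleIntegral f (ξ ω)
      = ∑ k, (e.symm k : ℝ) * (ξ ω (f ⁻¹' {(e.symm k : ℝ)})).toReal := fun ω => by
    rw [hsum fun y => y * (ξ ω (f ⁻¹' {y})).toReal]
    rfl
  simp_rw [h3]
  rw [lintegral_exp_sum_of_isPoissonProcess hξ (fun k => f.measurableSet_preimage _) ?_
    (fun k => hfin _ (Finset.mem_filter.1 (e.symm k).2).2) fun k => (e.symm k : ℝ),
    hsum fun y => μ.real (f ⁻¹' {y}) * (Real.exp y - 1), h1]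
  intro i j hij
  refine Disjoint.preimage _ (Set.disjoint_singleton.2 fun h => hij ?_)
  exact e.symm.injective (Subtype.ext h)

theorem hasSum_simpleIntegral [IsProbabilityMeasure P] {V : ℕ → Ω → S}
    (hξ : IsPoissonProcess (fun ω => Measure.sum fun i => Measure.dirac (V i ω)) μ P)
    {f : SimpleFunc S ℝ} (hf : Integrable f μ) :
    ∀ᵐ ω ∂P, HasSum (fun i => f (V i ω))
      (simpleIntegral f (Measure.sum fun i => Measure.dirac (V i ω))) := by
  have hfin : ∀ y ≠ 0, μ (f ⁻¹' {y}) ≠ ⊤ := fun y hy =>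
    ((SimpleFunc.integrable_iff.1 hf) y hy).ne
  have hae : ∀ᵐ ω ∂P, ∀ y ∈ f.range.filter (· ≠ 0),
      (Measure.sum fun i => Measure.dirac (V i ω)) (f ⁻¹' {y}) < ⊤ := by
    rw [Filter.eventually_all_finset]
    exact fun y hy => ae_lt_top_of_isPoissonProcess hξ (f.measurableSet_preimage _)
      (hfin y (Finset.mem_filter.1 hy).2)
  filter_upwards [hae] with ω hω
  have h1 : ∀ x, f x = ∑ y ∈ f.range with y ≠ 0, y * (f ⁻¹' {y}).indicator 1 x := by
    intro x
    by_cases hx : f x = 0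
    · rw [hx, Finset.sum_eq_zero]
      intro y hy
      have : x ∉ f ⁻¹' {y} := fun h => (Finset.mem_filter.1 hy).2 (by rw [← hx]; exact h.symm)
      simp [this]
    · rw [Finset.sum_eq_single_of_mem (f x)]
      · simp
      · simp [hx]
      · intro y _ hy
        have : x ∉ f ⁻¹' {y} := fun h => hy h.symm
        simp [this]
  simp_rw [h1]
  refine hasSum_sum fun y hy => HasSum.mul_left y ?_
  have h2 := hω y hy
  rw [Measure.sum_apply _ (f.measurableSet_preimage _)] at h2 ⊢
  have h3 := ENNReal.hasSum_toReal h2.ne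
  have h4 : ∀ i, (Measure.dirac (V i ω) (f ⁻¹' {y})).toReal
      = (f ⁻¹' {y}).indicator (1 : S → ℝ) (V i ω) := fun i => by
    rw [Measure.dirac_apply' _ (f.measurableSet_preimage _)]
    by_cases h : V i ω ∈ f ⁻¹' {y} <;> simp [h]
  rw [ENNReal.tsum_toReal_eq fun i => measure_ne_top _ _]
  simpa only [h4] using h3

/-- The increasing approximation of a nonnegative function by simple functions. -/
def realApprox (f : S → ℝ) (k : ℕ) : SimpleFunc S ℝ :=
  (SimpleFunc.eapprox (fun x => ENNReal.ofReal (f x)) k).map ENNReal.toReal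

theorem realApprox_nonneg (f : S → ℝ) (k : ℕ) (x : S) : 0 ≤ realApprox f k x :=
  ENNReal.toReal_nonneg

theorem realApprox_mono (f : S → ℝ) (x : S) : Monotone fun k => realApprox f k x :=
  fun _ l hkl => ENNReal.toReal_mono (SimpleFunc.eapprox_lt_top _ l x).ne
    (SimpleFunc.monotone_eapprox _ hkl x)

theorem tendsto_realApprox {f : S → ℝ} (hf : Measurable f) {x : S} (hx : 0 ≤ f x) :
    Tendsto (fun k => realApprox f k x) atTop (𝓝 (f x)) := by
  have h := (ENNReal.tendsto_toReal (ENNReal.ofReal_ne_top (r := f x))).comp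
    (SimpleFunc.tendsto_eapprox hf.ennreal_ofReal x)
  rwa [ENNReal.toReal_ofReal hx] at h

theorem realApprox_le {f : S → ℝ} (hf : Measurable f) {x : S} (hx : 0 ≤ f x) (k : ℕ) :
    realApprox f k x ≤ f x :=
  (realApprox_mono f x).ge_of_tendsto (tendsto_realApprox hf hx) k

theorem integrable_realApprox {f : S → ℝ} (hf : Measurable f) (h0 : ∀ x, 0 ≤ f x)
    (hi : Integrable f μ) (k : ℕ) : Integrable (realApprox f k) μ :=
  hi.mono' (realApprox f k).aestronglyMeasurable <| ae_of_all _ fun x => by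
    rw [Real.norm_of_nonneg (realApprox_nonneg f k x)]
    exact realApprox_le hf (h0 x) k

/-- For nonnegative `f`, the exponential moment of a partial sum is bounded by the Laplace
functional. -/
theorem lintegral_exp_sum_range_le [IsProbabilityMeasure P] {V : ℕ → Ω → S}
    (hV : ∀ i, Measurable (V i))
    (hξ : IsPoissonProcess (fun ω => Measure.sum fun i => Measure.dirac (V i ω)) μ P)
    {f g : S → ℝ} (hf : Measurable f) (h0 : ∀ x, 0 ≤ f x) (hi : Integrable f μ)
    (hg : Integrable g μ) (hfg : ∀ x, Real.exp (f x) - 1 ≤ g x) (M : ℕ) :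
    ∫⁻ ω, ENNReal.ofReal (Real.exp (∑ i ∈ Finset.range M, f (V i ω))) ∂P
      ≤ ENNReal.ofReal (Real.exp (∫ x, g x ∂μ)) := by
  have hlim : Tendsto (fun k => ∫⁻ ω, ENNReal.ofReal
      (Real.exp (∑ i ∈ Finset.range M, realApprox f k (V i ω))) ∂P) atTop
      (𝓝 (∫⁻ ω, ENNReal.ofReal (Real.exp (∑ i ∈ Finset.range M, f (V i ω))) ∂P)) := by
    refine lintegral_tendsto_of_tendsto_of_monotone (fun k => ?_) (ae_of_all _ fun ω => ?_)
      (ae_of_all _ fun ω => ?_)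
    · refine (Measurable.ennreal_ofReal (Measurable.exp
        (Finset.measurable_fun_sum _ fun i _ => ?_))).aemeasurable
      exact (realApprox f k).measurable.comp (hV i)
    · intro k l hkl
      exact ENNReal.ofReal_le_ofReal (Real.exp_le_exp.2
        (Finset.sum_le_sum fun i _ => realApprox_mono f _ hkl))
    · exact (ENNReal.continuous_ofReal.tendsto _).comp ((Real.continuous_exp.tendsto _).comp
        (tendsto_finsetSum _ fun i _ => tendsto_realApprox hf (h0 _)))
  refine le_of_tendsto' hlim fun k => ?_
  have hik := integrable_realApprox hf h0 hi k
  calc ∫⁻ ω, ENNReal.ofReal (Real.exp (∑ i ∈ Finset.range M, realApprox f k (V i ω))) ∂P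
      ≤ ∫⁻ ω, ENNReal.ofReal (Real.exp (simpleIntegral (realApprox f k)
          (Measure.sum fun i => Measure.dirac (V i ω)))) ∂P := by
        refine lintegral_mono_ae ?_
        filter_upwards [hasSum_simpleIntegral hξ hik] with ω hω
        exact ENNReal.ofReal_le_ofReal (Real.exp_le_exp.2
          (sum_le_hasSum _ (fun i _ => realApprox_nonneg _ _ _) hω))
    _ = ENNReal.ofReal (Real.exp (∫ x, (Real.exp (realApprox f k x) - 1) ∂μ)) :=
        lintegral_exp_simpleIntegral hξ hik
    _ ≤ _ := by
        refine ENNReal.ofReal_le_ofReal (Real.exp_le_exp.2 (integral_mono_of_nonneg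
          (ae_of_all _ fun x => ?_) hg (ae_of_all _ fun x => ?_)))
        · simpa using realApprox_nonneg f k x
        · exact le_trans (sub_le_sub_right (Real.exp_le_exp.2 (realApprox_le hf (h0 x) k)) 1)
            (hfg x)

/-- For nonpositive simple functions, the exponential moments of the partial sums decrease to the
Laplace functional. -/
theorem tendsto_lintegral_exp_sum_range [IsProbabilityMeasure P] {V : ℕ → Ω → S}
    (hV : ∀ i, Measurable (V i))
    (hξ : IsPoissonProcess (fun ω => Measure.sum fun i => Measure.dirac (V i ω)) μ P)
    {f : SimpleFunc S ℝ} (h0 : ∀ x, f x ≤ 0) (hi : Integrable f μ) :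
    Tendsto (fun M => ∫⁻ ω, ENNReal.ofReal (Real.exp (∑ i ∈ Finset.range M, f (V i ω))) ∂P) atTop
      (𝓝 (ENNReal.ofReal (Real.exp (∫ x, (Real.exp (f x) - 1) ∂μ)))) := by
  rw [← lintegral_exp_simpleIntegral hξ hi]
  refine tendsto_lintegral_of_dominated_convergence (fun _ => 1) (fun M => ?_)
    (fun M => ae_of_all _ fun ω => ?_) (by simp) ?_
  · exact Measurable.ennreal_ofReal (Measurable.exp
        (Finset.measurable_fun_sum _ fun i _ => f.measurable.comp (hV i)))
  · rw [← ENNReal.ofReal_one]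
    exact ENNReal.ofReal_le_ofReal (Real.exp_le_one_iff.2 (Finset.sum_nonpos fun i _ => h0 _))
  · filter_upwards [hasSum_simpleIntegral hξ hi] with ω hω
    exact (ENNReal.continuous_ofReal.tendsto _).comp ((Real.continuous_exp.tendsto _).comp
      hω.tendsto_sum_nat)

end Poisson

/-! ### Exponential tail bounds for weighted sums of gains -/

/-- The space of locations and levels. -/
abbrev PointSpace : Type := EuclideanSpace ℝ (Fin 2) × ℝ

/-- The intensity measure of the points. -/
def pointIntensity : Measure PointSpace :=
  (volume : Measure (EuclideanSpace ℝ (Fin 2))).prod ((volume : Measure ℝ).restrict (Set.Ici 0))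

theorem exp_add_sq_sub_one_le {s : ℝ} (hs : |s| ≤ 1 / 2) :
    Real.exp (s + s ^ 2) - 1 ≤ s + 4 * s ^ 2 := by
  obtain ⟨h1, h2⟩ := abs_le.1 hs
  have h3 : |s + s ^ 2| ≤ 1 := by
    rw [abs_le]
    constructor <;> nlinarith
  have h4 := (abs_le.1 (Real.abs_exp_sub_one_sub_id_le h3)).2
  nlinarith [sq_nonneg s, mul_nonneg (sq_nonneg s) (by linarith : 0 ≤ 1 / 2 - s),
    mul_nonneg (sq_nonneg s) (by nlinarith : 0 ≤ 1 / 4 - s ^ 2)]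

namespace Network

variable {Ω : Type*} (net : Network Ω)

/-- Location and level of the base station `i`. -/
def point (i : ℕ) (ω : Ω) : PointSpace := (net.pos i ω, net.level i ω)

/-- The power gain of the interfering base station `i` with `N` antennas. -/
def gain (N i : ℕ) (ω : Ω) : ℝ := interferenceGain N i fun l => net.chan l ω

theorem gain_nonneg (N i : ℕ) (ω : Ω) : 0 ≤ net.gain N i ω := interferenceGain_nonneg _ _ _

/-- The sum of the gains of all points, weighted by a function of location and level. -/
def weightedGain (w : PointSpace → ℝ) (N : ℕ) (ω : Ω) : ENNReal :=
  ∑' i, ENNReal.ofReal (w (net.point i ω) * net.gain N i ω)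

variable [MeasurableSpace Ω] {net} {P : Measure Ω}

theorem HasModelLaw.measurable_point (hnet : net.HasModelLaw P) (i : ℕ) :
    Measurable (net.point i) := (hnet.measurable_pos i).prodMk (hnet.measurable_level i)

theorem HasModelLaw.measurable_gain (hnet : net.HasModelLaw P) (N i : ℕ) :
    Measurable (net.gain N i) :=
  measurable_interferenceGain (fun _ => hnet.measurable_chan _) fun _ => hnet.measurable_chan _

theorem HasModelLaw.isPoissonProcess (hnet : net.HasModelLaw P) :
    IsPoissonProcess (fun ω => Measure.sum fun i => Measure.dirac (net.point i ω))
      pointIntensity P := hnet.poisson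

theorem HasModelLaw.lintegral_exp_sum_le [IsProbabilityMeasure P] (hnet : net.HasModelLaw P)
    {N : ℕ} (hN : 1 ≤ N) {s : PointSpace → ℝ} (hs : Measurable s) (hs' : ∀ x, |s x| ≤ 1 / 2)
    (M : ℕ) :
    ∫⁻ ω, ENNReal.ofReal (Real.exp (∑ i ∈ Finset.range M,
        s (net.point i ω) * net.gain N i ω)) ∂P
      ≤ ∫⁻ ω, ENNReal.ofReal (Real.exp (∑ i ∈ Finset.range M,
        (s (net.point i ω) + s (net.point i ω) ^ 2))) ∂P :=
  lintegral_exp_sum_interferenceGain_le hnet.measurable_chan hnet.chan_law hnet.chan_indep hN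
    hnet.measurable_point hnet.chan_indep_points hs hs' M

/-- Chernoff bound for the upper tail. -/
theorem HasModelLaw.measure_lt_weightedGain_le [IsProbabilityMeasure P] (hnet : net.HasModelLaw P)
    {N : ℕ} (hN : 1 ≤ N) {w : PointSpace → ℝ} (hw : Measurable w) (hw0 : ∀ x, 0 ≤ w x) {B : ℝ}
    (hwB : ∀ x, w x ≤ B) (hi : Integrable w pointIntensity) {θ : ℝ} (hθ : 0 ≤ θ)
    (hθB : θ * B ≤ 1 / 2) (a : ℝ) (ha : 0 ≤ a) :
    P {ω | ENNReal.ofReal a < net.weightedGain w N ω} ≤ ENNReal.ofReal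
      (Real.exp (-(θ * a) + (θ + 4 * θ ^ 2 * B) * ∫ x, w x ∂pointIntensity)) := by
  have hθw : ∀ x, θ * w x ≤ 1 / 2 := fun x =>
    (mul_le_mul_of_nonneg_left (hwB x) hθ).trans hθB
  have hθw0 : ∀ x, 0 ≤ θ * w x := fun x => mul_nonneg hθ (hw0 x)
  have hθw' : ∀ x, |θ * w x| ≤ 1 / 2 := fun x => by rw [abs_of_nonneg (hθw0 x)]; exact hθw x
  let E : ℕ → Set Ω := fun M =>
    {ω | a < ∑ i ∈ Finset.range M, w (net.point i ω) * net.gain N i ω}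
  have hterm : ∀ i ω, 0 ≤ w (net.point i ω) * net.gain N i ω := fun i ω =>
    mul_nonneg (hw0 _) (net.gain_nonneg _ _ _)
  have hE : {ω | ENNReal.ofReal a < net.weightedGain w N ω} = ⋃ M, E M := by
    ext ω
    simp only [Set.mem_ofPred_eq, Set.mem_iUnion, weightedGain, ENNReal.tsum_eq_iSup_nat,
      lt_iSup_iff, E]
    refine exists_congr fun M => ?_
    rw [← ENNReal.ofReal_sum_of_nonneg fun i _ => hterm i ω]
    exact ENNReal.ofReal_lt_ofReal_iff_of_nonneg ha
  have hmono : Monotone E := fun M M' hMM' ω hω => lt_of_lt_of_le hω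
    (Finset.sum_le_sum_of_subset_of_nonneg (Finset.range_mono hMM') fun i _ _ => hterm i ω)
  rw [hE, hmono.measure_iUnion]
  refine iSup_le fun M => ?_
  have hfi : Integrable (fun x => θ * w x + (θ * w x) ^ 2) pointIntensity := by
    refine ((hi.const_mul θ).const_mul 2).mono' (by fun_prop) (ae_of_all _ fun x => ?_)
    rw [Real.norm_of_nonneg (add_nonneg (hθw0 x) (sq_nonneg _))]
    nlinarith [hθw x, hθw0 x]
  have hexp : ∫⁻ ω, ENNReal.ofReal (Real.exp (∑ i ∈ Finset.range M,
        (θ * w (net.point i ω)) * net.gain N i ω)) ∂P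
      ≤ ENNReal.ofReal (Real.exp ((θ + 4 * θ ^ 2 * B) * ∫ x, w x ∂pointIntensity)) := by
    refine (hnet.lintegral_exp_sum_le hN (hw.const_mul θ) hθw' M).trans ?_
    refine (lintegral_exp_sum_range_le (f := fun x => θ * w x + (θ * w x) ^ 2)
      (g := fun x => (θ + 4 * θ ^ 2 * B) * w x) hnet.measurable_point hnet.isPoissonProcess
      (by fun_prop) (fun x => add_nonneg (hθw0 x) (sq_nonneg _)) hfi (hi.const_mul _)
      (fun x => (exp_add_sq_sub_one_le (hθw' x)).trans ?_) M).trans ?_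
    · have : θ ^ 2 * w x * w x ≤ θ ^ 2 * w x * B :=
        mul_le_mul_of_nonneg_left (hwB x) (mul_nonneg (sq_nonneg _) (hw0 x))
      nlinarith
    · rw [integral_const_mul]
  calc P (E M) ≤ P {ω | ENNReal.ofReal (Real.exp (θ * a)) ≤ ENNReal.ofReal
        (Real.exp (∑ i ∈ Finset.range M, (θ * w (net.point i ω)) * net.gain N i ω))} := by
        refine measure_mono fun ω hω => ENNReal.ofReal_le_ofReal (Real.exp_le_exp.2 ?_)
        simp_rw [mul_assoc]
        rw [← Finset.mul_sum]
        exact mul_le_mul_of_nonneg_left (le_of_lt hω) hθ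
    _ ≤ (∫⁻ ω, ENNReal.ofReal (Real.exp (∑ i ∈ Finset.range M,
        (θ * w (net.point i ω)) * net.gain N i ω)) ∂P) / ENNReal.ofReal (Real.exp (θ * a)) := by
        refine meas_ge_le_lintegral_div ?_ (by simp [Real.exp_pos]) ENNReal.ofReal_ne_top
        refine (Measurable.ennreal_ofReal (Measurable.exp
          (Finset.measurable_fun_sum _ fun i _ => ?_))).aemeasurable
        exact ((hw.comp (hnet.measurable_point i)).const_mul θ).mul (hnet.measurable_gain N i)
    _ ≤ _ := by
        refine (ENNReal.div_le_div_right hexp _).trans ?_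
        rw [← ENNReal.ofReal_div_of_pos (Real.exp_pos _), ← Real.exp_sub]
        exact ENNReal.ofReal_le_ofReal (Real.exp_le_exp.2 (by linarith))

/-- Chernoff bound for the lower tail. -/
theorem HasModelLaw.measure_weightedGain_lt_le [IsProbabilityMeasure P] (hnet : net.HasModelLaw P)
    {N : ℕ} (hN : 1 ≤ N) {w : PointSpace → ℝ} (hw : Measurable w) (hw0 : ∀ x, 0 ≤ w x) {B : ℝ}
    (hwB : ∀ x, w x ≤ B) (hi : Integrable w pointIntensity) {θ : ℝ} (hθ : 0 ≤ θ)
    (hθB : θ * B ≤ 1 / 2) (a : ℝ) :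
    P {ω | net.weightedGain w N ω < ENNReal.ofReal a} ≤ ENNReal.ofReal
      (Real.exp (θ * a - (θ - 4 * θ ^ 2 * B) * ∫ x, w x ∂pointIntensity)) := by
  -- It is enough to bound the lower tail for the simple minorants of `w`.
  let m : ℕ → ℝ := fun k => ∫ x, realApprox w k x ∂pointIntensity
  have hm : Tendsto m atTop (𝓝 (∫ x, w x ∂pointIntensity)) :=
    tendsto_integral_of_dominated_convergence w
      (fun k => (realApprox w k).aestronglyMeasurable) hi
      (fun k => ae_of_all _ fun x => by
        rw [Real.norm_of_nonneg (realApprox_nonneg _ _ _)]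
        exact realApprox_le hw (hw0 x) k)
      (ae_of_all _ fun x => tendsto_realApprox hw (hw0 x))
  have hlim : Tendsto (fun k => ENNReal.ofReal
      (Real.exp (θ * a - (θ - 4 * θ ^ 2 * B) * m k))) atTop (𝓝 (ENNReal.ofReal
      (Real.exp (θ * a - (θ - 4 * θ ^ 2 * B) * ∫ x, w x ∂pointIntensity)))) :=
    (ENNReal.continuous_ofReal.tendsto _).comp ((Real.continuous_exp.tendsto _).comp
      ((hm.const_mul _).const_sub _))
  refine ge_of_tendsto' hlim fun k => ?_
  let h := realApprox w k
  have hh0 : ∀ x, 0 ≤ h x := realApprox_nonneg w k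
  have hhw : ∀ x, h x ≤ w x := fun x => realApprox_le hw (hw0 x) k
  have hhi : Integrable h pointIntensity := integrable_realApprox hw hw0 hi k
  have hs0 : ∀ x, 0 ≤ θ * h x := fun x => mul_nonneg hθ (hh0 x)
  have hs1 : ∀ x, θ * h x ≤ 1 / 2 := fun x =>
    (mul_le_mul_of_nonneg_left ((hhw x).trans (hwB x)) hθ).trans hθB
  have hs' : ∀ x, |-(θ * h x)| ≤ 1 / 2 := fun x => by
    rw [abs_neg, abs_of_nonneg (hs0 x)]; exact hs1 x
  let f : SimpleFunc PointSpace ℝ := h.map fun y => -(θ * y) + (-(θ * y)) ^ 2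
  have hf : ∀ x, f x = -(θ * h x) + (-(θ * h x)) ^ 2 := fun x => rfl
  have hfi : Integrable f pointIntensity := by
    refine (hhi.const_mul θ).mono' f.aestronglyMeasurable (ae_of_all _ fun x => ?_)
    rw [hf, Real.norm_eq_abs, abs_le]
    constructor <;> nlinarith [hs0 x, hs1 x]
  have hbound : ∀ M, P {ω | net.weightedGain w N ω < ENNReal.ofReal a}
      ≤ ENNReal.ofReal (Real.exp (θ * a)) * ∫⁻ ω, ENNReal.ofReal
        (Real.exp (∑ i ∈ Finset.range M, f (net.point i ω))) ∂P := by
    intro M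
    calc P {ω | net.weightedGain w N ω < ENNReal.ofReal a}
        ≤ P {ω | ENNReal.ofReal (Real.exp (-(θ * a))) ≤ ENNReal.ofReal
          (Real.exp (∑ i ∈ Finset.range M, -(θ * h (net.point i ω)) * net.gain N i ω))} := by
          refine measure_mono fun ω hω => ENNReal.ofReal_le_ofReal (Real.exp_le_exp.2 ?_)
          have h1 : ENNReal.ofReal (∑ i ∈ Finset.range M, w (net.point i ω) * net.gain N i ω)
              < ENNReal.ofReal a := by
            refine lt_of_le_of_lt ?_ hω
            rw [ENNReal.ofReal_sum_of_nonneg fun i _ =>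
              mul_nonneg (hw0 _) (net.gain_nonneg _ _ _)]
            exact ENNReal.sum_le_tsum _
          have h2 := (ENNReal.ofReal_lt_ofReal_iff'.1 h1).1
          have h3 : ∑ i ∈ Finset.range M, h (net.point i ω) * net.gain N i ω
              ≤ ∑ i ∈ Finset.range M, w (net.point i ω) * net.gain N i ω :=
            Finset.sum_le_sum fun i _ => mul_le_mul_of_nonneg_right (hhw _) (net.gain_nonneg _ _ _)
          simp_rw [← neg_mul, mul_assoc]
          rw [← Finset.mul_sum]
          nlinarith
      _ ≤ (∫⁻ ω, ENNReal.ofReal (Real.exp (∑ i ∈ Finset.range M,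
          -(θ * h (net.point i ω)) * net.gain N i ω)) ∂P)
            / ENNReal.ofReal (Real.exp (-(θ * a))) := by
          refine meas_ge_le_lintegral_div ?_ (by simp [Real.exp_pos]) ENNReal.ofReal_ne_top
          refine (Measurable.ennreal_ofReal (Measurable.exp
            (Finset.measurable_fun_sum _ fun i _ => ?_))).aemeasurable
          exact ((h.measurable.comp (hnet.measurable_point i)).const_mul θ).neg.mul
            (hnet.measurable_gain N i)
      _ ≤ (∫⁻ ω, ENNReal.ofReal (Real.exp (∑ i ∈ Finset.range M, f (net.point i ω))) ∂P)
            / ENNReal.ofReal (Real.exp (-(θ * a))) :=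
          ENNReal.div_le_div_right (hnet.lintegral_exp_sum_le hN
            (s := fun x => -(θ * h x)) (h.measurable.const_mul θ).neg hs' M) _
      _ = _ := by
          rw [ENNReal.div_eq_inv_mul, ← ENNReal.ofReal_inv_of_pos (Real.exp_pos _),
            ← Real.exp_neg, neg_neg]
  have hlim2 := ENNReal.Tendsto.const_mul (a := ENNReal.ofReal (Real.exp (θ * a)))
    (tendsto_lintegral_exp_sum_range hnet.measurable_point hnet.isPoissonProcess
      (f := f) (fun x => by rw [hf]; nlinarith [hs0 x, hs1 x]) hfi)
    (Or.inr ENNReal.ofReal_ne_top)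
  refine (ge_of_tendsto' hlim2 hbound).trans ?_
  rw [← ENNReal.ofReal_mul (Real.exp_pos _).le, ← Real.exp_add]
  refine ENNReal.ofReal_le_ofReal (Real.exp_le_exp.2 ?_)
  have hle : ∫ x, (Real.exp (f x) - 1) ∂pointIntensity
      ≤ ∫ x, -(θ - 4 * θ ^ 2 * B) * h x ∂pointIntensity := by
    have hfi' : Integrable (fun x => Real.exp (f x) - 1) pointIntensity := by
      have : Integrable (f.map fun y => Real.exp y - 1) pointIntensity := by
        rw [SimpleFunc.integrable_iff_finMeasSupp] at hfi ⊢
        exact hfi.map (by simp)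
      exact this
    refine integral_mono hfi' (hhi.const_mul _) fun x => ?_
    rw [hf]
    refine (exp_add_sq_sub_one_le (hs' x)).trans ?_
    have : θ ^ 2 * h x * h x ≤ θ ^ 2 * h x * B :=
      mul_le_mul_of_nonneg_left ((hhw x).trans (hwB x)) (mul_nonneg (sq_nonneg _) (hh0 x))
    nlinarith
  rw [integral_const_mul] at hle
  change _ ≤ θ * a - (θ - 4 * θ ^ 2 * B) * ∫ x, h x ∂pointIntensity
  linarith

end Network

/-! ### Weights, and tail bounds in terms of the density -/

/-- The weight `f x` for the points `(x, t)` whose level `t` is at most `lam`. -/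
def levelWeight (f : EuclideanSpace ℝ (Fin 2) → ℝ) (lam : ℝ) (p : PointSpace) : ℝ :=
  f p.1 * (Set.Iic lam).indicator 1 p.2

section LevelWeight

variable {f : EuclideanSpace ℝ (Fin 2) → ℝ}

theorem levelWeight_of_le (f : EuclideanSpace ℝ (Fin 2) → ℝ) {lam : ℝ} {p : PointSpace}
    (h : p.2 ≤ lam) : levelWeight f lam p = f p.1 := by
  simp [levelWeight, h]

theorem levelWeight_of_lt (f : EuclideanSpace ℝ (Fin 2) → ℝ) {lam : ℝ} {p : PointSpace}
    (h : lam < p.2) : levelWeight f lam p = 0 := by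
  simp [levelWeight, h]

theorem measurable_levelWeight (hf : Measurable f) (lam : ℝ) : Measurable (levelWeight f lam) :=
  (hf.comp measurable_fst).mul
    ((measurable_one.indicator measurableSet_Iic).comp measurable_snd)

theorem levelWeight_nonneg (h0 : ∀ x, 0 ≤ f x) (lam : ℝ) (p : PointSpace) :
    0 ≤ levelWeight f lam p := by
  rcases le_or_gt p.2 lam with h | h
  · rw [levelWeight_of_le f h]; exact h0 _
  · rw [levelWeight_of_lt f h]

theorem levelWeight_le (h0 : ∀ x, 0 ≤ f x) {B : ℝ} (hB : ∀ x, f x ≤ B) (lam : ℝ)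
    (p : PointSpace) : levelWeight f lam p ≤ B := by
  rcases le_or_gt p.2 lam with h | h
  · rw [levelWeight_of_le f h]; exact hB _
  · rw [levelWeight_of_lt f h]; exact (h0 p.1).trans (hB p.1)

theorem levelWeight_mono (h0 : ∀ x, 0 ≤ f x) {lam lam' : ℝ} (h : lam ≤ lam') (p : PointSpace) :
    levelWeight f lam p ≤ levelWeight f lam' p := by
  rcases le_or_gt p.2 lam with hp | hp
  · rw [levelWeight_of_le f hp, levelWeight_of_le f (hp.trans h)]
  · rw [levelWeight_of_lt f hp]; exact levelWeight_nonneg h0 _ _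

theorem integrable_level_indicator (lam : ℝ) :
    Integrable ((Set.Iic lam).indicator (1 : ℝ → ℝ)) (volume.restrict (Set.Ici 0)) := by
  refine (integrable_indicator_iff measurableSet_Iic).2 (integrableOn_const ?_)
  rw [Measure.restrict_apply measurableSet_Iic]
  exact ne_top_of_le_ne_top (measure_Icc_lt_top (a := (0 : ℝ)) (b := lam)).ne
    (measure_mono fun x hx => ⟨hx.2, hx.1⟩)

theorem integrable_levelWeight (hf : Integrable f) (lam : ℝ) :
    Integrable (levelWeight f lam) pointIntensity :=
  hf.mul_prod (integrable_level_indicator lam)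

theorem integral_levelWeight (f : EuclideanSpace ℝ (Fin 2) → ℝ) {lam : ℝ} (hlam : 0 ≤ lam) :
    ∫ p, levelWeight f lam p ∂pointIntensity = lam * ∫ x, f x := by
  unfold levelWeight pointIntensity
  rw [integral_prod_mul, integral_indicator measurableSet_Iic,
    Measure.restrict_restrict measurableSet_Iic, Set.inter_comm, Set.Ici_inter_Iic]
  simp [hlam, mul_comm]

end LevelWeight

namespace Network

variable {Ω : Type*} {net : Network Ω}

theorem weightedGain_levelWeight_mono {f : EuclideanSpace ℝ (Fin 2) → ℝ} (h0 : ∀ x, 0 ≤ f x)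
    {lam lam' : ℝ} (h : lam ≤ lam') (N : ℕ) (ω : Ω) :
    net.weightedGain (levelWeight f lam) N ω ≤ net.weightedGain (levelWeight f lam') N ω :=
  ENNReal.tsum_le_tsum fun _ => ENNReal.ofReal_le_ofReal
    (mul_le_mul_of_nonneg_right (levelWeight_mono h0 h _) (net.gain_nonneg _ _ _))

variable [MeasurableSpace Ω] {P : Measure Ω}

/-- A parameter for which the quadratic error term in the Chernoff bounds is negligible. -/
theorem exists_chernoff_parameter {B m ε : ℝ} (hB : 0 < B) (hm : 0 ≤ m) (hε : 0 < ε) :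
    ∃ θ : ℝ, 0 < θ ∧ θ * B ≤ 1 / 2 ∧ 4 * θ * B * m ≤ ε / 2 := by
  refine ⟨min (1 / (2 * B)) (ε / (8 * B * (m + 1))), by positivity, ?_, ?_⟩
  · calc min (1 / (2 * B)) (ε / (8 * B * (m + 1))) * B ≤ 1 / (2 * B) * B :=
          mul_le_mul_of_nonneg_right (min_le_left _ _) hB.le
      _ = 1 / 2 := by field_simp
  · calc 4 * min (1 / (2 * B)) (ε / (8 * B * (m + 1))) * B * m
        ≤ 4 * (ε / (8 * B * (m + 1))) * B * m := by gcongr; exact min_le_right _ _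
      _ = ε / 2 * (m / (m + 1)) := by field_simp; ring
      _ ≤ ε / 2 * 1 := by
          gcongr
          rw [div_le_one (by linarith)]
          linarith
      _ = ε / 2 := mul_one _

/-- Deviations of the weighted gain from its mean `lam * ∫ f` by more than `ε * lam + b` have
probability exponentially small in `lam` and in `b`. -/
theorem HasModelLaw.exists_tail_bounds [IsProbabilityMeasure P] (hnet : net.HasModelLaw P)
    {f : EuclideanSpace ℝ (Fin 2) → ℝ} (hf : Measurable f) (h0 : ∀ x, 0 ≤ f x) {B : ℝ}
    (hB : ∀ x, f x ≤ B) (hi : Integrable f) {ε : ℝ} (hε : 0 < ε) :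
    ∃ θ c : ℝ, 0 < θ ∧ 0 < c ∧ ∀ lam : ℝ, 0 ≤ lam → ∀ b : ℝ, 0 ≤ b → ∀ N : ℕ, 1 ≤ N →
      P {ω | ENNReal.ofReal (lam * ((∫ x, f x) + ε) + b)
          < net.weightedGain (levelWeight f lam) N ω}
        ≤ ENNReal.ofReal (Real.exp (-(c * lam) - θ * b)) ∧
      P {ω | net.weightedGain (levelWeight f lam) N ω
          < ENNReal.ofReal (lam * ((∫ x, f x) - ε) - b)}
        ≤ ENNReal.ofReal (Real.exp (-(c * lam) - θ * b)) := by
  have hm : 0 ≤ ∫ x, f x := integral_nonneg h0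
  have hB0 : 0 ≤ B := (h0 0).trans (hB 0)
  obtain ⟨θ, hθ, hθB, hθm⟩ := exists_chernoff_parameter (B := B + 1) (by linarith) hm hε
  have hB' : ∀ x, f x ≤ B + 1 := fun x => (hB x).trans (by linarith)
  refine ⟨θ, θ * ε / 2, hθ, by positivity, fun lam hlam b hb N hN => ?_⟩
  have hquad : θ * lam * (4 * θ * (B + 1) * ∫ x, f x) ≤ θ * lam * (ε / 2) :=
    mul_le_mul_of_nonneg_left hθm (mul_nonneg hθ.le hlam)
  constructor
  · refine (hnet.measure_lt_weightedGain_le hN (measurable_levelWeight hf lam)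
      (levelWeight_nonneg h0 lam) (levelWeight_le h0 hB' lam) (integrable_levelWeight hi lam)
      hθ.le hθB _ (by positivity)).trans ?_
    rw [integral_levelWeight f hlam]
    refine ENNReal.ofReal_le_ofReal (Real.exp_le_exp.2 ?_)
    linarith
  · refine (hnet.measure_weightedGain_lt_le hN (measurable_levelWeight hf lam)
      (levelWeight_nonneg h0 lam) (levelWeight_le h0 hB' lam) (integrable_levelWeight hi lam)
      hθ.le hθB _).trans ?_
    rw [integral_levelWeight f hlam]
    refine ENNReal.ofReal_le_ofReal (Real.exp_le_exp.2 ?_)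
    linarith

/-- Borel–Cantelli, uniformly in the number of antennas. -/
theorem ae_exists_forall_notMem {E : ℕ → ℕ → Set Ω} {c : ℝ} (hc : 0 < c)
    (hE : ∀ n N : ℕ, 1 ≤ N →
      P (E n N) ≤ ENNReal.ofReal (Real.exp (-(c * n) - 2 * Real.log N))) :
    ∀ᵐ ω ∂P, ∃ n₀, ∀ n ≥ n₀, ∀ N ≥ 1, ω ∉ E n N := by
  have hs1 : Summable fun n : ℕ => Real.exp (-c) ^ n :=
    summable_geometric_of_lt_one (Real.exp_pos _).le (Real.exp_lt_one_iff.2 (by linarith))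
  have hs2 : Summable fun k : ℕ => 1 / ((k + 1 : ℕ) : ℝ) ^ 2 :=
    (summable_nat_add_iff (f := fun k : ℕ => 1 / (k : ℝ) ^ 2) 1).2
      (Real.summable_one_div_nat_pow.2 one_lt_two)
  have hs := hs1.mul_of_nonneg hs2 (fun n => by positivity) (fun n => by positivity)
  have hle : ∀ p : ℕ × ℕ, P (E p.1 (p.2 + 1))
      ≤ ENNReal.ofReal (Real.exp (-c) ^ p.1 * (1 / ((p.2 + 1 : ℕ) : ℝ) ^ 2)) := by
    intro p
    have hpos : (0 : ℝ) < ((p.2 + 1 : ℕ) : ℝ) := by positivity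
    have heq : Real.exp (-(c * p.1) - 2 * Real.log (p.2 + 1 : ℕ))
        = Real.exp (-c) ^ p.1 * (1 / ((p.2 + 1 : ℕ) : ℝ) ^ 2) := by
      rw [Real.exp_sub, two_mul, Real.exp_add, Real.exp_log hpos, ← Real.exp_nat_mul,
        show -(c * (p.1 : ℝ)) = (p.1 : ℝ) * -c by ring]
      ring
    rw [← heq]
    exact hE p.1 (p.2 + 1) (by omega)
  have hsum : ∑' p : ℕ × ℕ, P (E p.1 (p.2 + 1)) ≠ ⊤ :=
    ne_top_of_le_ne_top hs.tsum_ofReal_ne_top (ENNReal.tsum_le_tsum hle)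
  filter_upwards [ae_finite_setOfPred_mem hsum] with ω hω
  obtain ⟨n₀, hn₀⟩ := (hω.image Prod.fst).bddAbove
  refine ⟨n₀ + 1, fun n hn N hN hmem => ?_⟩
  have : n ∈ Prod.fst '' {p : ℕ × ℕ | ω ∈ E p.1 (p.2 + 1)} :=
    ⟨(n, N - 1), by simpa [Nat.sub_add_cancel hN] using hmem, rfl⟩
  have := hn₀ this
  omega

/-- Almost surely, the weighted gain at density `lam` is `lam * ∫ f + o(lam) + O(log N)`,
uniformly in the number `N` of antennas. -/
theorem HasModelLaw.ae_eventually_weightedGain [IsProbabilityMeasure P]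
    (hnet : net.HasModelLaw P) {f : EuclideanSpace ℝ (Fin 2) → ℝ} (hf : Measurable f)
    (h0 : ∀ x, 0 ≤ f x) {B : ℝ} (hB : ∀ x, f x ≤ B) (hi : Integrable f) {ε : ℝ} (hε : 0 < ε) :
    ∃ K : ℝ, 0 < K ∧ ∀ᵐ ω ∂P, ∀ᶠ lam : ℝ in atTop, ∀ N : ℕ, 1 ≤ N →
      net.weightedGain (levelWeight f lam) N ω
          ≤ ENNReal.ofReal (lam * ((∫ x, f x) + ε) + K * Real.log N) ∧
      ENNReal.ofReal (lam * ((∫ x, f x) - ε) - K * Real.log N)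
          ≤ net.weightedGain (levelWeight f lam) N ω := by
  have hm : 0 ≤ ∫ x, f x := integral_nonneg h0
  set m := ∫ x, f x with hmdef
  obtain ⟨θ, c, hθ, hc, hbound⟩ := hnet.exists_tail_bounds hf h0 hB hi (half_pos hε)
  -- With this choice the tail probabilities are summable over the density and over `N`.
  set K := 2 / θ with hKdef
  have hK : ∀ N : ℕ, θ * (K * Real.log N) = 2 * Real.log N := fun N => by
    rw [hKdef]
    field_simp
  have hb : ∀ N : ℕ, 0 ≤ K * Real.log N := fun N =>
    mul_nonneg (by positivity) (Real.log_natCast_nonneg N)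
  refine ⟨K, by positivity, ?_⟩
  filter_upwards [ae_exists_forall_notMem hc fun n N hN =>
      hK N ▸ (hbound n n.cast_nonneg _ (hb N) N hN).1,
    ae_exists_forall_notMem hc fun n N hN =>
      hK N ▸ (hbound n n.cast_nonneg _ (hb N) N hN).2]
    with ω ⟨n₁, h₁⟩ ⟨n₂, h₂⟩
  filter_upwards [eventually_ge_atTop (n₁ : ℝ), eventually_ge_atTop ((n₂ : ℝ) + 1),
    eventually_ge_atTop ((m + ε) * 2 / ε), eventually_ge_atTop 0] with lam hl1 hl2 hl3 hl0 N hN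
  have hl3' : m + ε ≤ lam * (ε / 2) := by
    rw [div_le_iff₀ hε] at hl3
    linarith
  -- Real densities are compared with the neighbouring integers by monotonicity in the density.
  constructor
  · have h3 := not_lt.1 (h₁ ⌈lam⌉₊ (by exact_mod_cast hl1.trans (Nat.le_ceil lam)) N hN)
    refine (weightedGain_levelWeight_mono h0 (Nat.le_ceil lam) N ω).trans (h3.trans ?_)
    refine ENNReal.ofReal_le_ofReal ?_
    have h4 := (Nat.ceil_lt_add_one hl0).le
    have h5 := mul_le_mul_of_nonneg_right h4 (by linarith : 0 ≤ m + ε / 2)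
    linarith
  · have h3 := not_lt.1 (h₂ ⌊lam⌋₊ (Nat.le_floor (by linarith)) N hN)
    refine le_trans ?_ (h3.trans (weightedGain_levelWeight_mono h0 (Nat.floor_le hl0) N ω))
    have h4 := mul_le_mul_of_nonneg_right (Nat.lt_floor_add_one lam).le hm
    have h5 := mul_le_mul_of_nonneg_right (Nat.floor_le hl0) (half_pos hε).le
    refine ENNReal.ofReal_le_ofReal ?_
    linarith

end Network

/-! ### Path loss and interference -/

/-- The path loss outside of the disc of radius `δ`. Summed against the gains, it is a lower bound
for the interference as soon as the serving base station lies in the disc. -/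
def outerPathLoss (L : ℝ → ℝ) (δ : ℝ) : EuclideanSpace ℝ (Fin 2) → ℝ :=
  (Metric.closedBall 0 δ)ᶜ.indicator fun x => L ‖x‖

namespace PhysicallyFeasible

variable {L : ℝ → ℝ}

theorem pathLossIntegral_pos (hL : PhysicallyFeasible L) : 0 < pathLossIntegral L :=
  hL.integral_pos

theorem pos (hL : PhysicallyFeasible L) : 0 < L 0 := by
  by_contra h
  have h0 : ∀ r ∈ Set.Ioi (0 : ℝ), r * L r = 0 := fun r hr => by
    have h1 := hL.le_zero r (le_of_lt hr)
    have h2 := hL.nonneg r (le_of_lt hr)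
    rw [le_antisymm (h1.trans (not_lt.1 h)) h2, mul_zero]
  have h3 := hL.integral_pos
  rw [setIntegral_congr_fun measurableSet_Ioi h0] at h3
  simp at h3

theorem integrable_norm (hL : PhysicallyFeasible L) :
    Integrable fun x : EuclideanSpace ℝ (Fin 2) => L ‖x‖ := by
  rw [integrable_fun_norm_addHaar (volume : Measure (EuclideanSpace ℝ (Fin 2)))]
  simpa using hL.integrable

theorem integral_norm (L : ℝ → ℝ) :
    ∫ x : EuclideanSpace ℝ (Fin 2), L ‖x‖ = 2 * Real.pi * pathLossIntegral L := by
  rw [integral_fun_norm_addHaar (volume : Measure (EuclideanSpace ℝ (Fin 2)))]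
  simp [pathLossIntegral, measureReal_def, Real.pi_pos.le, mul_assoc]

theorem measurable_norm (hL : PhysicallyFeasible L) :
    Measurable fun x : EuclideanSpace ℝ (Fin 2) => L ‖x‖ :=
  hL.measurable.comp _root_.measurable_norm

theorem measurable_outerPathLoss (hL : PhysicallyFeasible L) (δ : ℝ) :
    Measurable (outerPathLoss L δ) :=
  hL.measurable_norm.indicator Metric.isClosed_closedBall.measurableSet.compl

theorem integrable_outerPathLoss (hL : PhysicallyFeasible L) (δ : ℝ) :
    Integrable (outerPathLoss L δ) :=
  hL.integrable_norm.indicator Metric.isClosed_closedBall.measurableSet.compl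

theorem outerPathLoss_nonneg (hL : PhysicallyFeasible L) (δ : ℝ)
    (x : EuclideanSpace ℝ (Fin 2)) : 0 ≤ outerPathLoss L δ x :=
  Set.indicator_nonneg (fun x _ => hL.nonneg _ (norm_nonneg x)) x

theorem outerPathLoss_le (hL : PhysicallyFeasible L) (δ : ℝ) (x : EuclideanSpace ℝ (Fin 2)) :
    outerPathLoss L δ x ≤ L 0 :=
  Set.indicator_le' (fun x _ => hL.le_zero _ (norm_nonneg x)) (fun _ _ => hL.pos.le) x

theorem exists_lt_integral_outerPathLoss (hL : PhysicallyFeasible L) {ε : ℝ} (hε : 0 < ε) :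
    ∃ δ : ℝ, 0 < δ ∧ 2 * Real.pi * pathLossIntegral L - ε < ∫ x, outerPathLoss L δ x := by
  have hlim : Tendsto (fun k : ℕ => ∫ x, outerPathLoss L (1 / ((k : ℝ) + 1)) x) atTop
      (𝓝 (∫ x : EuclideanSpace ℝ (Fin 2), L ‖x‖)) := by
    refine tendsto_integral_of_dominated_convergence (fun x => L ‖x‖)
      (fun k => (hL.measurable_outerPathLoss _).aestronglyMeasurable) hL.integrable_norm
      (fun k => ae_of_all _ fun x => ?_) ?_
    · rw [Real.norm_of_nonneg (hL.outerPathLoss_nonneg _ x)]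
      exact Set.indicator_le_self' (fun x _ => hL.nonneg _ (norm_nonneg x)) x
    · have h0 : ∀ᵐ x : EuclideanSpace ℝ (Fin 2), x ≠ 0 :=
        measure_eq_zero_iff_ae_notMem.1 (measure_singleton (0 : EuclideanSpace ℝ (Fin 2)))
      filter_upwards [h0] with x hx
      refine tendsto_const_nhds.congr' ?_
      filter_upwards [tendsto_one_div_add_atTop_nhds_zero_nat.eventually
        (gt_mem_nhds (norm_pos_iff.2 hx))] with k hk
      rw [outerPathLoss, Set.indicator_of_mem]
      simpa using hk
  rw [integral_norm] at hlim
  obtain ⟨k, hk⟩ := (hlim.eventually (lt_mem_nhds (sub_lt_self _ hε))).exists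
  exact ⟨_, by positivity, hk⟩

end PhysicallyFeasible

/-- The indicator function of the disc of radius `δ`. -/
def discIndicator (δ : ℝ) : EuclideanSpace ℝ (Fin 2) → ℝ := (Metric.closedBall 0 δ).indicator 1

theorem measurable_discIndicator (δ : ℝ) : Measurable (discIndicator δ) :=
  measurable_one.indicator Metric.isClosed_closedBall.measurableSet

theorem discIndicator_nonneg (δ : ℝ) (x : EuclideanSpace ℝ (Fin 2)) : 0 ≤ discIndicator δ x :=
  Set.indicator_nonneg (fun _ _ => zero_le_one) x

theorem discIndicator_le_one (δ : ℝ) (x : EuclideanSpace ℝ (Fin 2)) : discIndicator δ x ≤ 1 :=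
  Set.indicator_le' (fun _ _ => le_rfl) (fun _ _ => zero_le_one) x

theorem integral_discIndicator_pos {δ : ℝ} (hδ : 0 < δ) : 0 < ∫ x, discIndicator δ x := by
  unfold discIndicator
  rw [integral_indicator_one Metric.isClosed_closedBall.measurableSet, measureReal_def]
  exact ENNReal.toReal_pos (Metric.measure_closedBall_pos _ _ hδ).ne'
    measure_closedBall_lt_top.ne

theorem integrable_discIndicator (δ : ℝ) : Integrable (discIndicator δ) := by
  refine (integrable_indicator_iff Metric.isClosed_closedBall.measurableSet).2 ?_
  exact integrableOn_const (C := (1 : ℝ)) measure_closedBall_lt_top.ne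

namespace Network

variable {Ω : Type*} {net : Network Ω}

theorem servingDist_nonneg (lam : ℝ) (ω : Ω) : 0 ≤ net.servingDist lam ω :=
  Real.sInf_nonneg (by rintro d ⟨i, -, rfl⟩; exact norm_nonneg _)

theorem servingDist_le {lam : ℝ} {ω : Ω} {i : ℕ} (h : net.level i ω ≤ lam) :
    net.servingDist lam ω ≤ ‖net.pos i ω‖ :=
  csInf_le ⟨0, by rintro d ⟨i, -, rfl⟩; exact norm_nonneg _⟩ ⟨i, h, rfl⟩

/-- Bounds the serving distance without reference to void probabilities: if the disc of radius
`δ` carries a positive weighted gain, then it contains a base station. -/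
theorem servingDist_le_of_weightedGain_pos {δ lam : ℝ} {N : ℕ} {ω : Ω}
    (h : 0 < net.weightedGain (levelWeight (discIndicator δ) lam) N ω) :
    net.servingDist lam ω ≤ δ := by
  by_contra hδ
  refine h.ne' (ENNReal.tsum_eq_zero.2 fun i => ?_)
  rcases le_or_gt (net.level i ω) lam with hi | hi
  · have hpos : net.pos i ω ∉ Metric.closedBall 0 δ := by
      have := servingDist_le hi
      rw [mem_closedBall_zero_iff]
      linarith
    rw [levelWeight_of_le _ (show (net.point i ω).2 ≤ lam from hi)]
    simp [point, discIndicator, hpos]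
  · rw [levelWeight_of_lt _ (show lam < (net.point i ω).2 from hi)]
    simp

variable {L : ℝ → ℝ}

theorem interference_eq_tsum (L : ℝ → ℝ) (N : ℕ) (lam : ℝ) (ω : Ω) :
    net.interference L N lam ω = ∑' i,
      {i | net.level i ω ≤ lam ∧ net.servingDist lam ω < ‖net.pos i ω‖}.indicator
        (fun i => L ‖net.pos i ω‖ * net.gain N i ω) i :=
  tsum_subtype {i | net.level i ω ≤ lam ∧ net.servingDist lam ω < ‖net.pos i ω‖}
    fun i => L ‖net.pos i ω‖ * net.gain N i ω

theorem interference_term_nonneg (hL : PhysicallyFeasible L) (N : ℕ) (lam : ℝ) (ω : Ω) (i : ℕ) :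
    0 ≤ {i | net.level i ω ≤ lam ∧ net.servingDist lam ω < ‖net.pos i ω‖}.indicator
        (fun i => L ‖net.pos i ω‖ * net.gain N i ω) i :=
  Set.indicator_nonneg
    (fun i _ => mul_nonneg (hL.nonneg _ (norm_nonneg _)) (net.gain_nonneg N i ω)) i

/-- The interference as an extended nonnegative sum.  The real sum is zero if this one is
infinite. -/
theorem interference_eq_toReal (hL : PhysicallyFeasible L) (N : ℕ) (lam : ℝ) (ω : Ω) :
    net.interference L N lam ω = (∑' i, ENNReal.ofReal
      ({i | net.level i ω ≤ lam ∧ net.servingDist lam ω < ‖net.pos i ω‖}.indicator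
        (fun i => L ‖net.pos i ω‖ * net.gain N i ω) i)).toReal := by
  rw [ENNReal.tsum_toReal_eq fun i => ENNReal.ofReal_ne_top, interference_eq_tsum]
  exact tsum_congr fun i => (ENNReal.toReal_ofReal (interference_term_nonneg hL N lam ω i)).symm

theorem interference_nonneg (hL : PhysicallyFeasible L) (N : ℕ) (lam : ℝ) (ω : Ω) :
    0 ≤ net.interference L N lam ω := by
  rw [interference_eq_toReal hL]
  exact ENNReal.toReal_nonneg

theorem interference_sum_le_weightedGain (hL : PhysicallyFeasible L) (N : ℕ) (lam : ℝ) (ω : Ω) :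
    (∑' i, ENNReal.ofReal
      ({i | net.level i ω ≤ lam ∧ net.servingDist lam ω < ‖net.pos i ω‖}.indicator
        (fun i => L ‖net.pos i ω‖ * net.gain N i ω) i))
      ≤ net.weightedGain (levelWeight (fun x => L ‖x‖) lam) N ω := by
  refine ENNReal.tsum_le_tsum fun i => ENNReal.ofReal_le_ofReal ?_
  by_cases hi : i ∈ {i | net.level i ω ≤ lam ∧ net.servingDist lam ω < ‖net.pos i ω‖}
  · rw [Set.indicator_of_mem hi, levelWeight_of_le _ (show (net.point i ω).2 ≤ lam from hi.1)]
    exact le_rfl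
  · rw [Set.indicator_of_notMem hi]
    exact mul_nonneg (levelWeight_nonneg (fun x => hL.nonneg _ (norm_nonneg x)) _ _)
      (net.gain_nonneg _ _ _)

theorem interference_le {N : ℕ} {lam a : ℝ} {ω : Ω} (hL : PhysicallyFeasible L) (ha : 0 ≤ a)
    (h : net.weightedGain (levelWeight (fun x => L ‖x‖) lam) N ω ≤ ENNReal.ofReal a) :
    net.interference L N lam ω ≤ a := by
  rw [interference_eq_toReal hL]
  exact ENNReal.toReal_le_of_le_ofReal ha ((interference_sum_le_weightedGain hL N lam ω).trans h)

theorem le_interference {N : ℕ} {lam a δ : ℝ} {ω : Ω} (hL : PhysicallyFeasible L)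
    (hfin : net.weightedGain (levelWeight (fun x => L ‖x‖) lam) N ω ≠ ⊤)
    (hδ : net.servingDist lam ω ≤ δ)
    (h : ENNReal.ofReal a ≤ net.weightedGain (levelWeight (outerPathLoss L δ) lam) N ω) :
    a ≤ net.interference L N lam ω := by
  rw [interference_eq_toReal hL, ← ENNReal.ofReal_le_iff_le_toReal
    (ne_top_of_le_ne_top hfin (interference_sum_le_weightedGain hL N lam ω))]
  refine h.trans (ENNReal.tsum_le_tsum fun i => ENNReal.ofReal_le_ofReal ?_)
  have h0 := interference_term_nonneg (net := net) hL N lam ω i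
  rcases le_or_gt (net.level i ω) lam with hi | hi
  · rw [levelWeight_of_le _ (show (net.point i ω).2 ≤ lam from hi)]
    by_cases hpos : net.pos i ω ∈ Metric.closedBall 0 δ
    · rw [outerPathLoss, Set.indicator_of_notMem (by simpa [point] using hpos), zero_mul]
      exact h0
    · rw [outerPathLoss, Set.indicator_of_mem (by simpa [point] using hpos),
        Set.indicator_of_mem]
      · exact le_rfl
      · exact ⟨hi, hδ.trans_lt (by simpa using hpos)⟩
  · rw [levelWeight_of_lt _ (show lam < (net.point i ω).2 from hi), zero_mul]
    exact h0

variable [MeasurableSpace Ω] {P : Measure Ω} [IsProbabilityMeasure P]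

theorem HasModelLaw.ae_eventually_servingDist_le (hnet : net.HasModelLaw P) {δ : ℝ}
    (hδ : 0 < δ) : ∀ᵐ ω ∂P, ∀ᶠ lam : ℝ in atTop, net.servingDist lam ω ≤ δ := by
  have hpos := integral_discIndicator_pos hδ
  obtain ⟨K, -, h⟩ := hnet.ae_eventually_weightedGain
    (measurable_discIndicator δ) (discIndicator_nonneg δ) (discIndicator_le_one δ)
    (integrable_discIndicator δ) (half_pos hpos)
  filter_upwards [h] with ω hω
  filter_upwards [hω, eventually_gt_atTop 0] with lam hlam hl0
  refine servingDist_le_of_weightedGain_pos (N := 1) (lt_of_lt_of_le ?_ (hlam 1 le_rfl).2)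
  rw [ENNReal.ofReal_pos]
  simp only [Nat.cast_one, Real.log_one, mul_zero, sub_zero]
  exact mul_pos hl0 (by linarith)

theorem HasModelLaw.ae_tendsto_servingDist (hnet : net.HasModelLaw P) :
    ∀ᵐ ω ∂P, Tendsto (fun lam => net.servingDist lam ω) atTop (𝓝 0) := by
  have h : ∀ᵐ ω ∂P, ∀ k : ℕ, ∀ᶠ lam : ℝ in atTop,
      net.servingDist lam ω ≤ 1 / ((k : ℝ) + 1) :=
    ae_all_iff.2 fun k => hnet.ae_eventually_servingDist_le (by positivity)
  filter_upwards [h] with ω hω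
  refine tendsto_order.2 ⟨fun a ha => Eventually.of_forall fun lam =>
    ha.trans_le (servingDist_nonneg lam ω), fun a ha => ?_⟩
  obtain ⟨k, hk⟩ := exists_nat_one_div_lt ha
  exact (hω k).mono fun lam hlam => hlam.trans_lt hk

/-- Almost surely, the interference is `2 π γ lam + o(lam) + O(log N)`, uniformly in the number
`N` of antennas. The upper bound counts all base stations, the lower bound only those outside of a
small disc, which eventually contains the serving base station. -/
theorem HasModelLaw.ae_eventually_interference (hnet : net.HasModelLaw P)
    (hL : PhysicallyFeasible L) {ε : ℝ} (hε : 0 < ε) :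
    ∃ K : ℝ, 0 < K ∧ ∀ᵐ ω ∂P, ∀ᶠ lam : ℝ in atTop, ∀ N : ℕ, 1 ≤ N →
      net.interference L N lam ω
          ≤ lam * (2 * Real.pi * pathLossIntegral L + ε) + K * Real.log N ∧
      lam * (2 * Real.pi * pathLossIntegral L - ε) - K * Real.log N
          ≤ net.interference L N lam ω := by
  obtain ⟨δ, hδ, hδint⟩ := hL.exists_lt_integral_outerPathLoss (half_pos hε)
  obtain ⟨K₁, hK₁, h₁⟩ := hnet.ae_eventually_weightedGain hL.measurable_norm
    (fun x => hL.nonneg _ (norm_nonneg x)) (fun x => hL.le_zero _ (norm_nonneg x))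
    hL.integrable_norm hε
  obtain ⟨K₂, hK₂, h₂⟩ := hnet.ae_eventually_weightedGain (hL.measurable_outerPathLoss δ)
    (hL.outerPathLoss_nonneg δ) (hL.outerPathLoss_le δ) (hL.integrable_outerPathLoss δ)
    (half_pos hε)
  rw [PhysicallyFeasible.integral_norm] at h₁
  have hγ : 0 < 2 * Real.pi * pathLossIntegral L :=
    mul_pos Real.two_pi_pos hL.pathLossIntegral_pos
  refine ⟨max K₁ K₂, lt_max_of_lt_left hK₁, ?_⟩
  filter_upwards [h₁, h₂, hnet.ae_eventually_servingDist_le hδ] with ω hω₁ hω₂ hωδ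
  filter_upwards [hω₁, hω₂, hωδ, eventually_ge_atTop 0] with lam hl₁ hl₂ hlδ hl0 N hN
  have hlog : 0 ≤ Real.log N := Real.log_natCast_nonneg N
  constructor
  · refine (interference_le hL (by positivity) (hl₁ N hN).1).trans ?_
    gcongr
    exact le_max_left _ _
  · refine le_trans ?_ (le_interference hL (ne_top_of_le_ne_top ENNReal.ofReal_ne_top
      (hl₁ N hN).1) hlδ (hl₂ N hN).2)
    have h1 : K₂ * Real.log N ≤ max K₁ K₂ * Real.log N := by
      gcongr
      exact le_max_right _ _
    have h2 := mul_le_mul_of_nonneg_left (by linarith :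
      2 * Real.pi * pathLossIntegral L - ε ≤ (∫ x, outerPathLoss L δ x) - ε / 2) hl0
    linarith

/-- The probability that the interference is much smaller than the density is exponentially
small. On the event, the total weighted gain is too large (it serves to exclude an infinite sum),
the gain outside of a disc is too small, or the disc contains no base station. -/
theorem HasModelLaw.exists_measure_interference_lt_le (hnet : net.HasModelLaw P)
    (hL : PhysicallyFeasible L) :
    ∃ b c : ℝ, 0 < b ∧ 0 < c ∧ ∀ lam : ℝ, 0 < lam → ∀ N : ℕ, 1 ≤ N →
      P {ω | net.interference L N lam ω < b * lam}
        ≤ ENNReal.ofReal (3 * Real.exp (-(c * lam))) := by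
  have hγ : 0 < 2 * Real.pi * pathLossIntegral L :=
    mul_pos Real.two_pi_pos hL.pathLossIntegral_pos
  obtain ⟨δ, hδ, hδint⟩ := hL.exists_lt_integral_outerPathLoss hγ
  rw [sub_self] at hδint
  have hball := integral_discIndicator_pos hδ
  obtain ⟨_, c₁, _, hc₁, h₁⟩ := hnet.exists_tail_bounds hL.measurable_norm
    (fun x => hL.nonneg _ (norm_nonneg x)) (fun x => hL.le_zero _ (norm_nonneg x))
    hL.integrable_norm one_pos
  obtain ⟨_, c₂, _, hc₂, h₂⟩ := hnet.exists_tail_bounds (hL.measurable_outerPathLoss δ)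
    (hL.outerPathLoss_nonneg δ) (hL.outerPathLoss_le δ) (hL.integrable_outerPathLoss δ)
    (half_pos hδint)
  obtain ⟨_, c₃, _, hc₃, h₃⟩ := hnet.exists_tail_bounds
    (measurable_discIndicator δ) (discIndicator_nonneg δ) (discIndicator_le_one δ)
    (integrable_discIndicator δ) (half_pos hball)
  refine ⟨(∫ x, outerPathLoss L δ x) / 2, min c₁ (min c₂ c₃), half_pos hδint,
    lt_min hc₁ (lt_min hc₂ hc₃), fun lam hlam N hN => ?_⟩
  have hb₁ := (h₁ lam hlam.le 0 le_rfl N hN).1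
  have hb₂ := (h₂ lam hlam.le 0 le_rfl N hN).2
  have hb₃ := (h₃ lam hlam.le 0 le_rfl N hN).2
  simp only [mul_zero, sub_zero, add_zero] at hb₁ hb₂ hb₃
  have hexp : ∀ c, min c₁ (min c₂ c₃) ≤ c → ENNReal.ofReal (Real.exp (-(c * lam)))
      ≤ ENNReal.ofReal (Real.exp (-(min c₁ (min c₂ c₃) * lam))) := fun c hc =>
    ENNReal.ofReal_le_ofReal (Real.exp_le_exp.2
      (neg_le_neg (mul_le_mul_of_nonneg_right hc hlam.le)))
  refine le_trans (measure_mono (fun ω hω => ?_)) ((measure_union_le _ _).trans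
    ((add_le_add ((measure_union_le _ _).trans (add_le_add
      (hb₁.trans (hexp c₁ (min_le_left _ _)))
      (hb₂.trans (hexp c₂ ((min_le_right _ _).trans (min_le_left _ _))))))
      (hb₃.trans (hexp c₃ ((min_le_right _ _).trans (min_le_right _ _))))).trans ?_))
  · by_contra hcon
    simp only [Set.mem_union, Set.mem_ofPred_eq, not_or, not_lt] at hcon
    obtain ⟨⟨hc1, hc2⟩, hc3⟩ := hcon
    refine not_lt.2 (le_interference hL (ne_top_of_le_ne_top ENNReal.ofReal_ne_top hc1)
      (servingDist_le_of_weightedGain_pos (lt_of_lt_of_le ?_ hc3)) ((le_of_eq ?_).trans hc2)) hω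
    · rw [ENNReal.ofReal_pos]
      exact mul_pos hlam (by linarith)
    · congr 1
      ring
  · rw [← ENNReal.ofReal_add (by positivity) (by positivity),
      ← ENNReal.ofReal_add (by positivity) (by positivity)]
    refine ENNReal.ofReal_le_ofReal (le_of_eq ?_)
    ring

end Network

/-! ### Asymptotics of `log (1 + κ N / lam)` -/

theorem log_one_add_mul_le {u x : ℝ} (hu : 0 ≤ u) (hx : 0 ≤ x) :
    Real.log (1 + u * x) ≤ max 1 x * Real.log (1 + u) := by
  have hlog : 0 ≤ Real.log (1 + u) := Real.log_nonneg (by linarith)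
  rcases le_total x 1 with h | h
  · calc Real.log (1 + u * x) ≤ Real.log (1 + u) :=
          Real.log_le_log (by positivity) (by nlinarith)
      _ ≤ max 1 x * Real.log (1 + u) := le_mul_of_one_le_left hlog (le_max_left _ _)
  · rw [max_eq_right h, ← Real.log_rpow (by linarith)]
    refine Real.log_le_log (by positivity) ?_
    rw [mul_comm u]
    exact one_add_mul_self_le_rpow_one_add (by linarith) h

theorem mul_log_le_log_one_add_mul {u x : ℝ} (hu : 0 ≤ u) (hx : 0 ≤ x) :
    min 1 x * Real.log (1 + u) ≤ Real.log (1 + u * x) := by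
  have hlog : 0 ≤ Real.log (1 + u) := Real.log_nonneg (by linarith)
  rcases le_total x 1 with h | h
  · rw [min_eq_right h, ← Real.log_rpow (by linarith)]
    refine Real.log_le_log (by positivity) ?_
    rw [mul_comm u]
    exact rpow_one_add_le_one_add_mul_self (by linarith) hx h
  · calc min 1 x * Real.log (1 + u) ≤ Real.log (1 + u) :=
          mul_le_of_le_one_left hlog (min_le_left _ _)
      _ ≤ Real.log (1 + u * x) := Real.log_le_log (by positivity) (by nlinarith)

theorem tendsto_div_of_log_bounds {α : Type*} {l : Filter α} {F ℓ : α → ℝ} {c c' : ℝ}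
    (hℓ : Tendsto ℓ l atTop) (h1 : ∀ᶠ a in l, ℓ a + c - 2 * Real.log (ℓ a) ≤ F a)
    (h2 : ∀ᶠ a in l, F a ≤ ℓ a + c') : Tendsto (fun a => F a / ℓ a) l (𝓝 1) := by
  have hlog : Tendsto (fun a => Real.log (ℓ a) / ℓ a) l (𝓝 0) :=
    (Real.isLittleO_log_id_atTop.tendsto_div_nhds_zero).comp hℓ
  have hc : ∀ d : ℝ, Tendsto (fun a => d / ℓ a) l (𝓝 0) := fun d => hℓ.const_div_atTop d
  have hlow : Tendsto (fun a => 1 + c / ℓ a - 2 * (Real.log (ℓ a) / ℓ a)) l (𝓝 1) := by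
    simpa using ((hc c).const_add 1).sub (hlog.const_mul 2)
  have hup : Tendsto (fun a => 1 + c' / ℓ a) l (𝓝 1) := by simpa using (hc c').const_add 1
  refine tendsto_of_tendsto_of_tendsto_of_le_of_le' hlow hup ?_ ?_
  · filter_upwards [h1, hℓ.eventually_gt_atTop 0] with a ha hpos
    rw [le_div_iff₀ hpos]
    refine le_trans (le_of_eq ?_) ha
    field_simp
  · filter_upwards [h2, hℓ.eventually_gt_atTop 0] with a ha hpos
    rw [div_le_iff₀ hpos]
    refine ha.trans (le_of_eq ?_)
    field_simp

section Scaling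

variable {Nt : ℝ → ℕ} {κ : ℝ}

/-- All scaling laws follow from the asymptotic equivalence `E ∼ lam * log₂ (1 + κ Nt / lam)`,
which holds whatever the growth of `Nt`. -/
theorem hasScalingLaws_of_tendsto (hκ : 0 < κ) (hNt : Tendsto Nt atTop atTop) {E : ℝ → ℝ}
    (hE : Tendsto (fun lam => E lam / (lam * Real.logb 2 (1 + κ * (Nt lam / lam)))) atTop (𝓝 1)) :
    HasScalingLaws Nt κ E := by
  have hN : Tendsto (fun lam => (Nt lam : ℝ)) atTop atTop :=
    tendsto_natCast_atTop_atTop.comp hNt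
  have hlog2 : 0 < Real.log 2 := Real.log_pos one_lt_two
  have hev : ∀ᶠ lam : ℝ in atTop, 0 < lam ∧ 0 < (Nt lam : ℝ) :=
    (eventually_gt_atTop 0).and (hN.eventually_gt_atTop 0)
  set G : ℝ → ℝ := fun lam => lam * Real.logb 2 (1 + κ * (Nt lam / lam)) with hG
  have hGpos : ∀ᶠ lam in atTop, 0 < G lam := by
    filter_upwards [hev] with lam ⟨h1, h2⟩
    exact mul_pos h1 (Real.logb_pos one_lt_two (by simp only [lt_add_iff_pos_right]; positivity))
  have hEG : ∀ᶠ lam in atTop, E lam = E lam / G lam * G lam := by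
    filter_upwards [hGpos] with lam h
    rw [div_mul_cancel₀ _ h.ne']
  have hGatTop : Tendsto G atTop atTop := by
    refine tendsto_atTop.2 fun b => ?_
    filter_upwards [hev, eventually_ge_atTop (2 * (|b| * Real.log 2)),
      hN.eventually_ge_atTop (2 * (|b| * Real.log 2) / κ)] with lam ⟨h1, h2⟩ h3 h4
    rw [div_le_iff₀ hκ] at h4
    have h5 := Real.one_sub_inv_le_log_of_pos (x := 1 + κ * (Nt lam / lam)) (by positivity)
    have h6 : |b| * Real.log 2 ≤ lam * (1 - (1 + κ * (Nt lam / lam))⁻¹) := by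
      have h7 : lam * (1 - (1 + κ * (Nt lam / lam))⁻¹)
          = lam * (κ * Nt lam) / (lam + κ * Nt lam) := by
        field_simp
        ring
      rw [h7, le_div_iff₀ (by positivity)]
      have h8 : 0 ≤ |b| * Real.log 2 := by positivity
      nlinarith [mul_nonneg h1.le (by linarith : 0 ≤ (Nt lam : ℝ) * κ - 2 * (|b| * Real.log 2)),
        mul_nonneg (mul_nonneg hκ.le h2.le) (by linarith : 0 ≤ lam - 2 * (|b| * Real.log 2))]
    have h9 := h6.trans (mul_le_mul_of_nonneg_left h5 h1.le)
    rw [hG]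
    simp only [Real.logb]
    rw [← mul_div_assoc, le_div_iff₀ hlog2]
    exact (mul_le_mul_of_nonneg_right (le_abs_self b) hlog2.le).trans h9
  refine ⟨?_, ?_, fun h => ?_, fun c hc h => ?_, fun h => ?_⟩
  · exact (hE.pos_mul_atTop one_pos hGatTop).congr' (hEG.mono fun lam h => h.symm)
  · have h1 : E =Θ[atTop] G :=
      ((isEquivalent_iff_tendsto_one (hGpos.mono fun _ h => h.ne')).2 hE).isTheta
    refine h1.trans ⟨IsBigO.of_bound (max 1 κ / Real.log 2) ?_,
      IsBigO.of_bound (Real.log 2 / min 1 κ) ?_⟩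
    · filter_upwards [hev, hGpos] with lam ⟨h1, h2⟩ h3
      have hu : 0 ≤ (Nt lam : ℝ) / lam := by positivity
      have hlog : 0 ≤ Real.log (1 + Nt lam / lam) := Real.log_nonneg (by linarith)
      rw [Real.norm_of_nonneg h3.le, Real.norm_of_nonneg (mul_nonneg h1.le hlog), hG]
      simp only [Real.logb]
      have := mul_le_mul_of_nonneg_left (log_one_add_mul_le hu hκ.le) h1.le
      rw [mul_comm κ]
      refine le_trans (le_of_eq ?_) ((div_le_div_of_nonneg_right this hlog2.le).trans
        (le_of_eq ?_)) <;> ring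
    · filter_upwards [hev, hGpos] with lam ⟨h1, h2⟩ h3
      have hu : 0 ≤ (Nt lam : ℝ) / lam := by positivity
      have hlog : 0 ≤ Real.log (1 + Nt lam / lam) := Real.log_nonneg (by linarith)
      have hmin : 0 < min 1 κ := lt_min one_pos hκ
      rw [Real.norm_of_nonneg h3.le, Real.norm_of_nonneg (mul_nonneg h1.le hlog), hG]
      simp only [Real.logb]
      have := mul_le_mul_of_nonneg_left (mul_log_le_log_one_add_mul hu hκ.le) h1.le
      rw [mul_comm κ, div_mul_eq_mul_div, le_div_iff₀ hmin, ← mul_div_assoc,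
        mul_div_cancel₀ _ hlog2.ne']
      linarith
  · have h1 : Tendsto (fun lam => lam / Nt lam * Real.log (1 + κ / (lam / Nt lam))) atTop (𝓝 κ) :=
      (Real.tendsto_mul_log_one_add_div_atTop κ).comp h
    have h2 := hE.mul (h1.div_const (Real.log 2))
    rw [one_mul] at h2
    refine h2.congr' ?_
    filter_upwards [hev, hEG] with lam ⟨h1, h2⟩ h3
    conv_rhs => rw [h3]
    rw [hG]
    simp only [Real.logb]
    rw [show κ / (lam / Nt lam) = κ * (Nt lam / lam) by field_simp]
    field_simp
  · have h1 : Tendsto (fun lam => Real.logb 2 (1 + κ / (lam / Nt lam))) atTop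
        (𝓝 (Real.logb 2 (1 + κ / c))) :=
      (Real.continuousAt_logb (by positivity)).tendsto.comp
        ((tendsto_const_nhds.div h hc.ne').const_add 1)
    have h2 := hE.mul h1
    rw [one_mul] at h2
    refine h2.congr' ?_
    filter_upwards [hev, hEG] with lam ⟨h1, h2⟩ h3
    conv_rhs => rw [h3]
    rw [hG]
    simp only
    rw [show κ / (lam / Nt lam) = κ * (Nt lam / lam) by field_simp]
    field_simp
  · have hu : Tendsto (fun lam => (Nt lam : ℝ) / lam) atTop atTop := by
      have h1 : Tendsto (fun lam : ℝ => lam / (Nt lam : ℝ)) atTop (𝓝[>] 0) :=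
        tendsto_nhdsWithin_iff.2 ⟨h, hev.mono fun lam hl => div_pos hl.1 hl.2⟩
      refine h1.inv_tendsto_nhdsGT_zero.congr fun lam => ?_
      rw [Pi.inv_apply, inv_div]
    have hlog : Tendsto (fun lam => Real.log (1 + Nt lam / lam)) atTop atTop :=
      Real.tendsto_log_atTop.comp (tendsto_atTop_add_const_left _ 1 hu)
    have hq : Tendsto (fun lam => Real.log (κ + (1 - κ) / (1 + Nt lam / lam))) atTop
        (𝓝 (Real.log κ)) := by
      have h1 : Tendsto (fun lam => κ + (1 - κ) / (1 + Nt lam / lam)) atTop (𝓝 κ) := by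
        simpa using ((tendsto_atTop_add_const_left _ 1 hu).const_div_atTop (1 - κ)).const_add κ
      exact (Real.continuousAt_log hκ.ne').tendsto.comp h1
    have h1 : Tendsto (fun lam => 1 + Real.log (κ + (1 - κ) / (1 + Nt lam / lam))
        / Real.log (1 + Nt lam / lam)) atTop (𝓝 1) := by
      simpa using (hq.div_atTop hlog).const_add 1
    have h2 := hE.mul h1
    rw [one_mul] at h2
    refine h2.congr' ?_
    filter_upwards [hev, hEG, hlog.eventually_gt_atTop 0] with lam ⟨h1, h2⟩ h3 h4
    conv_rhs => rw [h3]
    have hu : 0 < (Nt lam : ℝ) / lam := by positivity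
    have h5 : Real.log (1 + κ * (Nt lam / lam)) = Real.log (1 + Nt lam / lam)
        + Real.log (κ + (1 - κ) / (1 + Nt lam / lam)) := by
      have h6 : κ + (1 - κ) / (1 + Nt lam / lam)
          = (1 + κ * (Nt lam / lam)) / (1 + Nt lam / lam) := by
        rw [eq_div_iff (by positivity), add_mul, div_mul_cancel₀ _ (by positivity)]
        ring
      rw [h6, Real.log_div (by positivity) (by positivity)]
      ring
    have h7 : 1 + Real.log (κ + (1 - κ) / (1 + Nt lam / lam)) / Real.log (1 + Nt lam / lam)
        = G lam / (lam * Real.logb 2 (1 + Nt lam / lam)) := by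
      rw [hG]
      simp only [Real.logb]
      rw [h5, one_add_div h4.ne']
      have hlam := h1.ne'
      have hlg := h4.ne'
      rw [mul_div_mul_left _ _ hlam, div_div_div_cancel_right₀ hlog2.ne']
    rw [h7]
    exact (mul_div_assoc _ _ _).symm

/-- If the interference is `M lam + o(lam) + O(log N)` and the signal is `L₀ N + o(N)`, then
`log (1 + SINR)` is asymptotically equivalent to `log (1 + (L₀ / M) N / lam)`. -/
theorem tendsto_log_one_add_sinr_ratio (hNt : Tendsto Nt atTop atTop) {M L₀ σ2 : ℝ} (hM : 0 < M)
    (hL₀ : 0 < L₀) (hσ2 : 0 < σ2) {S I : ℝ → ℝ}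
    (hS : Tendsto (fun lam => S lam / Nt lam) atTop (𝓝 L₀)) (hI0 : ∀ lam, 0 ≤ I lam)
    (hI : ∀ ε : ℝ, 0 < ε → ∃ K : ℝ, 0 < K ∧ ∀ᶠ lam in atTop,
      I lam ≤ lam * (M + ε) + K * Real.log (Nt lam) ∧
      lam * (M - ε) - K * Real.log (Nt lam) ≤ I lam) :
    Tendsto (fun lam => Real.log (1 + S lam / (I lam + σ2))
      / Real.log (1 + L₀ / M * (Nt lam / lam))) atTop (𝓝 1) := by
  have hN : Tendsto (fun lam => (Nt lam : ℝ)) atTop atTop :=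
    tendsto_natCast_atTop_atTop.comp hNt
  have hℓ : Tendsto (fun lam => Real.log (Nt lam)) atTop atTop := Real.tendsto_log_atTop.comp hN
  set κ := L₀ / M with hκdef
  have hκ : 0 < κ := div_pos hL₀ hM
  -- The logarithmic error term is negligible for `log N ≤ √lam`; otherwise both logarithms are
  -- equivalent to `log N`.
  let s : Set ℝ := {lam | Real.log (Nt lam) ≤ Real.sqrt lam}
  have hsplit : (atTop : Filter ℝ) = atTop ⊓ 𝓟 s ⊔ atTop ⊓ 𝓟 sᶜ := by
    rw [← inf_sup_left, sup_principal, Set.union_compl_self, principal_univ, inf_top_eq]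
  have hev : ∀ᶠ lam : ℝ in atTop, 1 ≤ lam ∧ 1 ≤ (Nt lam : ℝ) ∧ 1 ≤ Real.log (Nt lam) :=
    (eventually_ge_atTop 1).and ((hN.eventually_ge_atTop 1).and (hℓ.eventually_ge_atTop 1))
  have hSev : ∀ᶠ lam in atTop, L₀ / 2 < S lam / Nt lam ∧ S lam / Nt lam < 2 * L₀ :=
    (hS.eventually (lt_mem_nhds (by linarith))).and (hS.eventually (gt_mem_nhds (by linarith)))
  rw [hsplit]
  refine Tendsto.sup ?_ ?_
  · have hl : atTop ⊓ 𝓟 s ≤ atTop := inf_le_left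
    have hs : ∀ᶠ lam in atTop ⊓ 𝓟 s, Real.log (Nt lam) ≤ Real.sqrt lam :=
      eventually_inf_principal.2 (Eventually.of_forall fun lam h => h)
    have hIlim : Tendsto (fun lam => I lam / lam) (atTop ⊓ 𝓟 s) (𝓝 M) := by
      rw [Metric.tendsto_nhds]
      intro ε hε
      obtain ⟨K, hK, h⟩ := hI (ε / 2) (half_pos hε)
      have hsq : Tendsto (fun lam : ℝ => K / Real.sqrt lam) atTop (𝓝 0) :=
        Real.tendsto_sqrt_atTop.const_div_atTop K
      filter_upwards [hl h, hs, hl (hsq.eventually (gt_mem_nhds (half_pos hε))), hl hev]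
        with lam ⟨h1, h2⟩ h3 h4 ⟨h5, _, _⟩
      have hlam : 0 < lam := by linarith
      have hsqrt : 0 < Real.sqrt lam := Real.sqrt_pos.2 hlam
      rw [div_lt_iff₀ hsqrt] at h4
      have h6 : K * Real.log (Nt lam) < ε / 2 * lam := by
        calc K * Real.log (Nt lam) ≤ K * Real.sqrt lam := by gcongr
          _ < ε / 2 * Real.sqrt lam * Real.sqrt lam := by gcongr
          _ = ε / 2 * lam := by rw [mul_assoc, Real.mul_self_sqrt hlam.le]
      rw [Real.dist_eq, abs_lt]
      constructor
      · rw [lt_sub_iff_add_lt, lt_div_iff₀ hlam]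
        nlinarith
      · rw [sub_lt_iff_lt_add, div_lt_iff₀ hlam]
        nlinarith
    have hx : Tendsto (fun lam => S lam / Nt lam / (I lam / lam + σ2 / lam) / κ) (atTop ⊓ 𝓟 s)
        (𝓝 1) := by
      have h0 : Tendsto (fun lam : ℝ => σ2 / lam) (atTop ⊓ 𝓟 s) (𝓝 0) :=
        (tendsto_id.const_div_atTop σ2).mono_left hl
      have h1 := ((hS.mono_left hl).div (hIlim.add h0) (by simpa using hM.ne')).div_const κ
      rwa [add_zero, div_self hκ.ne'] at h1
    have hmin := (tendsto_const_nhds (x := (1 : ℝ))).min hx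
    have hmax := (tendsto_const_nhds (x := (1 : ℝ))).max hx
    rw [min_self] at hmin
    rw [max_self] at hmax
    have hkey : ∀ᶠ lam in atTop ⊓ 𝓟 s,
        min 1 (S lam / Nt lam / (I lam / lam + σ2 / lam) / κ)
          ≤ Real.log (1 + S lam / (I lam + σ2)) / Real.log (1 + κ * (Nt lam / lam)) ∧
        Real.log (1 + S lam / (I lam + σ2)) / Real.log (1 + κ * (Nt lam / lam))
          ≤ max 1 (S lam / Nt lam / (I lam / lam + σ2 / lam) / κ) := by
      filter_upwards [hl hev, hl hSev] with lam ⟨h1, h2, _⟩ ⟨h3, _⟩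
      have hlam : 0 < lam := by linarith
      have hNpos : 0 < (Nt lam : ℝ) := by linarith
      have hu : 0 < κ * (Nt lam / lam) := by positivity
      have hD : 0 < Real.log (1 + κ * (Nt lam / lam)) := Real.log_pos (by linarith)
      have hIpos : 0 < I lam + σ2 := add_pos_of_nonneg_of_pos (hI0 lam) hσ2
      have hx0 : 0 ≤ S lam / Nt lam / (I lam / lam + σ2 / lam) / κ := by
        have h4 : 0 ≤ S lam / Nt lam := by linarith
        have h5 : 0 ≤ I lam / lam := div_nonneg (hI0 lam) hlam.le
        positivity
      have heq : S lam / (I lam + σ2)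
          = κ * (Nt lam / lam) * (S lam / Nt lam / (I lam / lam + σ2 / lam) / κ) := by
        rw [← add_div]
        field_simp
      rw [heq, le_div_iff₀ hD, div_le_iff₀ hD]
      exact ⟨mul_log_le_log_one_add_mul hu.le hx0, log_one_add_mul_le hu.le hx0⟩
    exact tendsto_of_tendsto_of_tendsto_of_le_of_le' hmin hmax (hkey.mono fun _ h => h.1)
      (hkey.mono fun _ h => h.2)
  · have hl : atTop ⊓ 𝓟 sᶜ ≤ atTop := inf_le_left
    have hs : ∀ᶠ lam in atTop ⊓ 𝓟 sᶜ, Real.sqrt lam < Real.log (Nt lam) :=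
      eventually_inf_principal.2 (Eventually.of_forall fun lam h => not_le.1 h)
    have hℓ' := hℓ.mono_left hl
    obtain ⟨K, hK, h⟩ := hI 1 one_pos
    have hsq : ∀ᶠ lam in atTop ⊓ 𝓟 sᶜ, lam ≤ Real.log (Nt lam) ^ 2 := by
      filter_upwards [hs, hl hev] with lam h1 ⟨h2, _, h3⟩
      exact (Real.sqrt_le_left (by linarith)).1 h1.le
    have hA : Tendsto (fun lam => Real.log (1 + S lam / (I lam + σ2)) / Real.log (Nt lam))
        (atTop ⊓ 𝓟 sᶜ) (𝓝 1) := by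
      refine tendsto_div_of_log_bounds (c := Real.log (L₀ / 2 / (M + 1 + K + σ2)))
        (c' := Real.log (1 + 2 * L₀ / σ2)) hℓ' ?_ ?_
      · filter_upwards [hsq, hl hev, hl hSev, hl h] with lam h1 ⟨h2, h3, h4⟩ ⟨h5, _⟩ ⟨h6, _⟩
        have hNpos : 0 < (Nt lam : ℝ) := by linarith
        have hIpos : 0 < I lam + σ2 := add_pos_of_nonneg_of_pos (hI0 lam) hσ2
        rw [lt_div_iff₀ hNpos] at h5
        set t := Real.log (Nt lam) with ht
        have h7 : I lam + σ2 ≤ (M + 1 + K + σ2) * t ^ 2 := by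
          have h8 : t ≤ t ^ 2 := by nlinarith
          nlinarith [mul_le_mul_of_nonneg_right h1 (by linarith : 0 ≤ M + 1),
            mul_le_mul_of_nonneg_left h8 hK.le, mul_le_mul_of_nonneg_left (h4.trans h8) hσ2.le]
        have hCpos : 0 < M + 1 + K + σ2 := by positivity
        have htpos : 0 < t := by linarith
        set q := L₀ / 2 / (M + 1 + K + σ2) with hq
        have hqpos : 0 < q := by positivity
        have h9 : t + Real.log q - 2 * Real.log t
            = Real.log (L₀ / 2 * Nt lam / ((M + 1 + K + σ2) * t ^ 2)) := by
          have h10 : L₀ / 2 * Nt lam / ((M + 1 + K + σ2) * t ^ 2) = Nt lam * q / t ^ 2 := by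
            rw [hq]
            field_simp
          rw [h10, Real.log_div (mul_pos hNpos hqpos).ne' (pow_pos htpos 2).ne',
            Real.log_mul hNpos.ne' hqpos.ne',
            Real.log_pow]
          push_cast
          ring
        have hSpos : 0 < S lam := lt_trans (by positivity) h5
        rw [h9]
        refine Real.log_le_log (by positivity) ?_
        calc L₀ / 2 * Nt lam / ((M + 1 + K + σ2) * t ^ 2) ≤ S lam / (I lam + σ2) := by
              gcongr
          _ ≤ 1 + S lam / (I lam + σ2) := by linarith
      · filter_upwards [hl hev, hl hSev] with lam ⟨h2, h3, h4⟩ ⟨h5, h6⟩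
        have hNpos : 0 < (Nt lam : ℝ) := by linarith
        rw [lt_div_iff₀ hNpos] at h5
        rw [div_lt_iff₀ hNpos] at h6
        have hSpos : 0 < S lam := lt_trans (by positivity) h5
        have hIpos : 0 < I lam + σ2 := add_pos_of_nonneg_of_pos (hI0 lam) hσ2
        rw [← Real.log_mul (by positivity) (by positivity)]
        refine Real.log_le_log (by positivity) ?_
        have h7 : S lam / (I lam + σ2) ≤ 2 * L₀ * Nt lam / σ2 := by
          gcongr
          linarith [hI0 lam]
        calc 1 + S lam / (I lam + σ2) ≤ Nt lam + 2 * L₀ * Nt lam / σ2 := add_le_add h3 h7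
          _ = Nt lam * (1 + 2 * L₀ / σ2) := by ring
    have hD : Tendsto (fun lam => Real.log (1 + κ * (Nt lam / lam)) / Real.log (Nt lam))
        (atTop ⊓ 𝓟 sᶜ) (𝓝 1) := by
      refine tendsto_div_of_log_bounds (c := Real.log κ) (c' := Real.log (1 + κ)) hℓ' ?_ ?_
      · filter_upwards [hsq, hl hev] with lam h1 ⟨h2, h3, h4⟩
        have hlam : 0 < lam := by linarith
        have hNpos : 0 < (Nt lam : ℝ) := by linarith
        have htpos : 0 < Real.log (Nt lam) := by linarith
        have h5 : Real.log lam ≤ 2 * Real.log (Real.log (Nt lam)) := by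
          refine (Real.log_le_log hlam h1).trans (le_of_eq ?_)
          rw [Real.log_pow]
          push_cast
          ring
        have h6 : Real.log (Nt lam) + Real.log κ - Real.log lam
            ≤ Real.log (1 + κ * (Nt lam / lam)) := by
          rw [← Real.log_mul hNpos.ne' hκ.ne', ← Real.log_div (by positivity) hlam.ne']
          refine Real.log_le_log (by positivity) ?_
          have : (Nt lam : ℝ) * κ / lam = κ * (Nt lam / lam) := by ring
          linarith
        linarith
      · filter_upwards [hl hev] with lam ⟨h2, h3, h4⟩
        have hNpos : 0 < (Nt lam : ℝ) := by linarith
        rw [← Real.log_mul (by positivity) (by positivity)]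
        refine Real.log_le_log (by positivity) ?_
        have h5 : (Nt lam : ℝ) / lam ≤ Nt lam := div_le_self hNpos.le h2
        nlinarith
    have h1 := hA.div hD one_ne_zero
    rw [div_one] at h1
    refine h1.congr' ?_
    filter_upwards [hℓ'.eventually_gt_atTop 0] with lam h2
    rw [Pi.div_apply, div_div_div_cancel_right₀ h2.ne']

end Scaling

/-! ### The serving channel -/

theorem integrable_normSq_complexGaussian :
    Integrable (fun z : ℂ => ‖z‖ ^ 2) complexGaussian :=
  Integrable.of_integral_ne_zero (by rw [integral_normSq_complexGaussian]; exact one_ne_zero)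

/-- The fourth moment of the squared modulus of a standard complex Gaussian is finite. -/
theorem integrable_normSq_pow_four_complexGaussian :
    Integrable (fun z : ℂ => (‖z‖ ^ 2) ^ 4) complexGaussian := by
  have hexp : Integrable (fun z : ℂ => Real.exp (1 / 2 * ‖z‖ ^ 2)) complexGaussian := by
    refine ⟨by fun_prop, ?_⟩
    rw [hasFiniteIntegral_iff_ofReal (ae_of_all _ fun z => (Real.exp_pos _).le),
      lintegral_exp_normSq_complexGaussian (by norm_num)]
    exact ENNReal.ofReal_lt_top
  refine (hexp.const_mul (Nat.factorial 4 * 2 ^ 4)).mono' (by fun_prop) (ae_of_all _ fun z => ?_)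
  rw [Real.norm_of_nonneg (by positivity)]
  have h := Real.pow_div_factorial_le_exp (1 / 2 * ‖z‖ ^ 2) (by positivity) 4
  rw [div_le_iff₀ (by positivity)] at h
  calc (‖z‖ ^ 2) ^ 4 = 2 ^ 4 * (1 / 2 * ‖z‖ ^ 2) ^ 4 := by ring
    _ ≤ 2 ^ 4 * (Real.exp (1 / 2 * ‖z‖ ^ 2) * Nat.factorial 4) := by gcongr
    _ = _ := by ring

/-- Maximum ratio transmission achieves the full power of the serving channel. -/
theorem powerGain_mrt_self {N : ℕ} (h : EuclideanSpace ℂ (Fin N)) :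
    powerGain h (mrt h) = ‖h‖ ^ 2 := by
  rw [powerGain, mrt, inner_smul_right, inner_self_eq_norm_sq_to_K, norm_mul, Complex.norm_real,
    norm_inv, norm_norm]
  rcases eq_or_ne ‖h‖ 0 with h0 | h0
  · simp [h0]
  · congr 1
    simp
    field_simp

namespace Network

variable {Ω : Type*} {net : Network Ω}

/-- The power `‖h₀‖²` of the serving channel with `N` antennas. -/
def servingPower (net : Network Ω) (N : ℕ) (ω : Ω) : ℝ :=
  ∑ n ∈ Finset.range N, ‖net.chan (.serving n) ω‖ ^ 2

theorem powerGain_servingVec (N : ℕ) (ω : Ω) :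
    powerGain (net.servingVec N ω) (mrt (net.servingVec N ω)) = net.servingPower N ω := by
  rw [powerGain_mrt_self, EuclideanSpace.norm_sq_eq, servingPower,
    Finset.sum_range fun n => ‖net.chan (.serving n) ω‖ ^ 2]
  rfl

theorem servingPower_nonneg (N : ℕ) (ω : Ω) : 0 ≤ net.servingPower N ω :=
  Finset.sum_nonneg fun _ _ => sq_nonneg _

theorem sinr_eq (L : ℝ → ℝ) (σ2 : ℝ) (N : ℕ) (lam : ℝ) (ω : Ω) :
    net.sinr L σ2 N lam ω = L (net.servingDist lam ω) * net.servingPower N ω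
      / (net.interference L N lam ω + σ2) := by
  rw [sinr, powerGain_servingVec]

variable [MeasurableSpace Ω] {P : Measure Ω}

theorem HasModelLaw.integral_chan (hnet : net.HasModelLaw P) (l : ChannelIndex) {f : ℂ → ℝ}
    (hf : Continuous f) : ∫ ω, f (net.chan l ω) ∂P = ∫ z, f z ∂complexGaussian := by
  rw [← hnet.chan_law l, integral_map (hnet.measurable_chan l).aemeasurable
    hf.aestronglyMeasurable]

theorem HasModelLaw.integrable_chan (hnet : net.HasModelLaw P) (l : ChannelIndex) {f : ℂ → ℝ}
    (hi : Integrable f complexGaussian) :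
    Integrable (fun ω => f (net.chan l ω)) P := by
  rw [← hnet.chan_law l] at hi
  exact hi.comp_measurable (hnet.measurable_chan l)

theorem HasModelLaw.measurable_servingPower (hnet : net.HasModelLaw P) (N : ℕ) :
    Measurable (net.servingPower N) :=
  Finset.measurable_fun_sum _ fun n _ => (hnet.measurable_chan (.serving n)).norm.pow_const 2

theorem HasModelLaw.integrable_servingPower (hnet : net.HasModelLaw P) (N : ℕ) :
    Integrable (net.servingPower N) P :=
  integrable_finsetSum _ fun n _ => hnet.integrable_chan (.serving n) (f := fun z => ‖z‖ ^ 2)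
    integrable_normSq_complexGaussian

theorem HasModelLaw.ae_tendsto_servingPower (hnet : net.HasModelLaw P) :
    ∀ᵐ ω ∂P, Tendsto (fun N : ℕ => net.servingPower N ω / N) atTop (𝓝 1) := by
  have hint : Integrable (fun ω => ‖net.chan (.serving 0) ω‖ ^ 2) P :=
    hnet.integrable_chan (.serving 0) (f := fun z => ‖z‖ ^ 2)
      integrable_normSq_complexGaussian
  have hind : Pairwise (Function.onFun (IndepFun · · P)
      fun n ω => ‖net.chan (.serving n) ω‖ ^ 2) := by
    intro n k hnk
    have h := hnet.chan_indep.indepFun (i := .serving n) (j := .serving k)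
      (by simpa using hnk)
    exact h.comp (φ := fun z => ‖z‖ ^ 2) (ψ := fun z => ‖z‖ ^ 2) (by fun_prop) (by fun_prop)
  have hid : ∀ n, IdentDistrib (fun ω => ‖net.chan (.serving n) ω‖ ^ 2)
      (fun ω => ‖net.chan (.serving 0) ω‖ ^ 2) P P := fun n =>
    IdentDistrib.comp (u := fun z => ‖z‖ ^ 2) ⟨(hnet.measurable_chan _).aemeasurable,
      (hnet.measurable_chan _).aemeasurable, by rw [hnet.chan_law, hnet.chan_law]⟩ (by fun_prop)
  have h := strong_law_ae_real (fun n ω => ‖net.chan (.serving n) ω‖ ^ 2) hint hind hid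
  rw [hnet.integral_chan (.serving 0) (f := fun z => ‖z‖ ^ 2) (by fun_prop),
    integral_normSq_complexGaussian] at h
  exact h

/-- The fourth moments of the normalized power of the serving channel are bounded. -/
theorem HasModelLaw.servingPower_pow_four (hnet : net.HasModelLaw P) {N : ℕ} (hN : 1 ≤ N) :
    Integrable (fun ω => (net.servingPower N ω / N) ^ 4) P ∧
      ∫ ω, (net.servingPower N ω / N) ^ 4 ∂P ≤ ∫ z, (‖z‖ ^ 2) ^ 4 ∂complexGaussian := by
  have hNpos : 0 < (N : ℝ) := by exact_mod_cast hN
  have hi : ∀ n, Integrable (fun ω => (‖net.chan (.serving n) ω‖ ^ 2) ^ 4) P := fun n =>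
    hnet.integrable_chan (.serving n) (f := fun z => (‖z‖ ^ 2) ^ 4)
      integrable_normSq_pow_four_complexGaussian
  have hsum : Integrable (fun ω => (∑ n ∈ Finset.range N,
      (‖net.chan (.serving n) ω‖ ^ 2) ^ 4) / N) P :=
    (integrable_finsetSum _ fun n _ => hi n).div_const _
  have hle : ∀ ω, (net.servingPower N ω / N) ^ 4
      ≤ (∑ n ∈ Finset.range N, (‖net.chan (.serving n) ω‖ ^ 2) ^ 4) / N := fun ω => by
    have h := pow_sum_div_card_le_sum_pow (s := Finset.range N)
      (f := fun n => ‖net.chan (.serving n) ω‖ ^ 2) (fun _ _ => sq_nonneg _) 3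
    rw [Finset.card_range, div_le_iff₀ (by positivity)] at h
    rw [servingPower, div_pow, div_le_div_iff₀ (by positivity) hNpos]
    simp only [Nat.reduceAdd] at h
    have h' := mul_le_mul_of_nonneg_right h hNpos.le
    linarith
  have hint : Integrable (fun ω => (net.servingPower N ω / N) ^ 4) P := by
    refine hsum.mono' (((hnet.measurable_servingPower N).div_const _).pow_const
      4).aestronglyMeasurable (ae_of_all _ fun ω => ?_)
    rw [Real.norm_of_nonneg (by positivity)]
    exact hle ω
  refine ⟨hint, (integral_mono hint hsum hle).trans (le_of_eq ?_)⟩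
  rw [integral_div, integral_finsetSum _ fun n _ => hi n, Finset.sum_congr rfl fun n _ =>
    hnet.integral_chan (.serving n) (f := fun z => (‖z‖ ^ 2) ^ 4) (by fun_prop)]
  simp
  field_simp

/-! ### Measurability of the SINR -/

theorem HasModelLaw.measurable_servingDist (hnet : net.HasModelLaw P) (lam : ℝ) :
    Measurable (net.servingDist lam) := by
  refine measurable_of_Iio fun x => ?_
  rcases le_or_gt x 0 with hx | hx
  · have : net.servingDist lam ⁻¹' Set.Iio x = ∅ := by
      ext ω
      simpa using hx.trans (servingDist_nonneg lam ω)
    rw [this]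
    exact MeasurableSet.empty
  · have : net.servingDist lam ⁻¹' Set.Iio x
        = (⋃ i, {ω | net.level i ω ≤ lam} ∩ {ω | ‖net.pos i ω‖ < x})
          ∪ ⋂ i, {ω | net.level i ω ≤ lam}ᶜ := by
      ext ω
      simp only [Set.mem_preimage, Set.mem_Iio, Set.mem_union, Set.mem_iUnion, Set.mem_inter_iff,
        Set.mem_ofPred_eq, Set.mem_iInter, Set.mem_compl_iff]
      by_cases h : ∃ i, net.level i ω ≤ lam
      · obtain ⟨k, hk⟩ := h
        have hlt := csInf_lt_iff (a := x)
          (s := {d : ℝ | ∃ i, net.level i ω ≤ lam ∧ d = ‖net.pos i ω‖})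
          ⟨0, by rintro d ⟨i, -, rfl⟩; exact norm_nonneg _⟩ ⟨_, k, hk, rfl⟩
        rw [servingDist, hlt]
        constructor
        · rintro ⟨d, ⟨i, hi, rfl⟩, hd⟩
          exact Or.inl ⟨i, hi, hd⟩
        · rintro (⟨i, hi, hd⟩ | hcon)
          · exact ⟨_, ⟨i, hi, rfl⟩, hd⟩
          · exact absurd hk (hcon k)
      · push Not at h
        have hempty : {d : ℝ | ∃ i, net.level i ω ≤ lam ∧ d = ‖net.pos i ω‖} = ∅ := by
          ext d
          simp only [Set.mem_ofPred_eq, Set.mem_empty_iff_false, iff_false]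
          rintro ⟨i, hi, -⟩
          exact absurd hi (not_le.2 (h i))
        -- Without base stations the serving distance is `sInf ∅ = 0`.
        rw [servingDist, hempty, Real.sInf_empty]
        exact ⟨fun _ => Or.inr fun i => not_le.2 (h i), fun _ => hx⟩
    rw [this]
    have h1 : ∀ i, MeasurableSet {ω | net.level i ω ≤ lam} := fun i =>
      measurableSet_le (hnet.measurable_level i) measurable_const
    exact (MeasurableSet.iUnion fun i => (h1 i).inter
      (measurableSet_lt (hnet.measurable_pos i).norm measurable_const)).union
      (MeasurableSet.iInter fun i => (h1 i).compl)

theorem HasModelLaw.measurable_interference (hnet : net.HasModelLaw P) {L : ℝ → ℝ}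
    (hL : PhysicallyFeasible L) (N : ℕ) (lam : ℝ) : Measurable (net.interference L N lam) := by
  have heq : net.interference L N lam = fun ω => (∑' i, ENNReal.ofReal
      ({ω | net.level i ω ≤ lam ∧ net.servingDist lam ω < ‖net.pos i ω‖}.indicator
        (fun ω => L ‖net.pos i ω‖ * net.gain N i ω) ω)).toReal :=
    funext fun ω => interference_eq_toReal hL N lam ω
  rw [heq]
  refine (Measurable.tsum fun i => (Measurable.indicator ?_ ?_).ennreal_ofReal).ennreal_toReal
  · exact (hL.measurable.comp (hnet.measurable_pos i).norm).mul (hnet.measurable_gain N i)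
  · exact (measurableSet_le (hnet.measurable_level i) measurable_const).inter
      (measurableSet_lt (hnet.measurable_servingDist lam) (hnet.measurable_pos i).norm)

theorem HasModelLaw.measurable_sinr (hnet : net.HasModelLaw P) {L : ℝ → ℝ}
    (hL : PhysicallyFeasible L) (σ2 : ℝ) (N : ℕ) (lam : ℝ) : Measurable (net.sinr L σ2 N lam) := by
  have heq : net.sinr L σ2 N lam = fun ω => L (net.servingDist lam ω) * net.servingPower N ω
      / (net.interference L N lam ω + σ2) := funext fun ω => sinr_eq L σ2 N lam ω
  rw [heq]
  exact ((hL.measurable.comp (hnet.measurable_servingDist lam)).mul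
    (hnet.measurable_servingPower N)).div ((hnet.measurable_interference hL N lam).add_const σ2)

end Network

/-! ### Convergence of means -/

/-- Almost sure convergence together with bounded second moments gives convergence of means. -/
theorem tendsto_integral_of_sq_le {Ω ι : Type*} [MeasurableSpace Ω] {P : Measure Ω}
    [IsProbabilityMeasure P] {l : Filter ι} [l.IsCountablyGenerated] {Y : ι → Ω → ℝ} {a C : ℝ}
    (hm : ∀ i, Measurable (Y i))
    (hsq : ∀ᶠ i in l, Integrable (fun ω => Y i ω ^ 2) P ∧ ∫ ω, Y i ω ^ 2 ∂P ≤ C)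
    (hlim : ∀ᵐ ω ∂P, Tendsto (fun i => Y i ω) l (𝓝 a)) :
    Tendsto (fun i => ∫ ω, Y i ω ∂P) l (𝓝 a) := by
  rw [Metric.tendsto_nhds]
  intro ε hε
  set D := 2 * |C| + 2 * a ^ 2 with hD
  have hD0 : 0 ≤ D := by positivity
  set M := 2 * (D + 1) / ε with hM
  have hMpos : 0 < M := by positivity
  have hDM : D / M < ε / 2 := by
    rw [hM, div_div_eq_mul_div, div_lt_div_iff₀ (by positivity) two_pos]
    nlinarith
  have htrunc : Tendsto (fun i => ∫ ω, min |Y i ω - a| M ∂P) l (𝓝 (∫ _, 0 ∂P)) := by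
    refine tendsto_integral_filter_of_dominated_convergence (fun _ => M)
      (Eventually.of_forall fun i => (((hm i).sub_const a).abs.min
        measurable_const).aestronglyMeasurable)
      (Eventually.of_forall fun i => ae_of_all _ fun ω => ?_) (integrable_const M) ?_
    · rw [Real.norm_of_nonneg (le_min (abs_nonneg _) hMpos.le)]
      exact min_le_right _ _
    · filter_upwards [hlim] with ω hω
      have h1 : Tendsto (fun i => |Y i ω - a|) l (𝓝 0) := by
        simpa using (hω.sub_const a).abs
      simpa [hMpos.le] using h1.min (tendsto_const_nhds (x := M))
  rw [integral_zero] at htrunc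
  filter_upwards [hsq, htrunc.eventually (gt_mem_nhds (half_pos hε))] with i ⟨h1, h2⟩ h3
  have hYi : Integrable (Y i) P :=
    ((memLp_two_iff_integrable_sq (hm i).aestronglyMeasurable).2 h1).integrable one_le_two
  have hZ : Integrable (fun ω => |Y i ω - a|) P := (hYi.sub (integrable_const a)).abs
  have hmin : Integrable (fun ω => min |Y i ω - a| M) P := hZ.inf (integrable_const M)
  have hquad : Integrable (fun ω => (2 * Y i ω ^ 2 + 2 * a ^ 2) / M) P :=
    ((h1.const_mul 2).add (integrable_const _)).div_const M
  have hle : ∫ ω, |Y i ω - a| ∂P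
      ≤ ∫ ω, (min |Y i ω - a| M + (2 * Y i ω ^ 2 + 2 * a ^ 2) / M) ∂P := by
    refine integral_mono hZ (hmin.add hquad) fun ω => ?_
    have h4 : 0 ≤ (2 * Y i ω ^ 2 + 2 * a ^ 2) / M := by positivity
    rcases le_total |Y i ω - a| M with h | h
    · simp only [min_eq_left h]
      linarith
    · simp only [min_eq_right h]
      have h5 : |Y i ω - a| ≤ (2 * Y i ω ^ 2 + 2 * a ^ 2) / M := by
        rw [le_div_iff₀ hMpos]
        calc |Y i ω - a| * M ≤ |Y i ω - a| * |Y i ω - a| := by gcongr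
          _ = (Y i ω - a) ^ 2 := by rw [← sq, sq_abs]
          _ ≤ 2 * Y i ω ^ 2 + 2 * a ^ 2 := by nlinarith [sq_nonneg (Y i ω + a)]
      linarith
  have hquad' : ∫ ω, (2 * Y i ω ^ 2 + 2 * a ^ 2) / M ∂P ≤ D / M := by
    rw [integral_div, integral_add (h1.const_mul 2) (integrable_const _), integral_const_mul,
      integral_const]
    simp only [probReal_univ, one_smul]
    gcongr
    linarith [le_abs_self C]
  rw [integral_add hmin hquad] at hle
  have hsub : ∫ ω, Y i ω ∂P - a = ∫ ω, (Y i ω - a) ∂P := by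
    rw [integral_sub hYi (integrable_const a)]
    simp
  rw [Real.dist_eq, hsub]
  calc |∫ ω, (Y i ω - a) ∂P| ≤ ∫ ω, |Y i ω - a| ∂P := abs_integral_le_integral_abs
    _ < ε := by linarith

namespace Network

variable {Ω : Type*} {net : Network Ω} {L : ℝ → ℝ} {σ2 : ℝ} {Nt : ℝ → ℕ}

theorem sinr_nonneg (hL : PhysicallyFeasible L) (hσ2 : 0 < σ2) (N : ℕ) (lam : ℝ) (ω : Ω) :
    0 ≤ net.sinr L σ2 N lam ω := by
  rw [sinr_eq]
  exact div_nonneg (mul_nonneg (hL.nonneg _ (servingDist_nonneg _ _)) (servingPower_nonneg _ _))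
    (add_nonneg (interference_nonneg hL _ _ _) hσ2.le)

theorem sinr_le (hL : PhysicallyFeasible L) {N : ℕ} {lam c : ℝ} {ω : Ω} (hc : 0 < c)
    (h : c ≤ net.interference L N lam ω + σ2) :
    net.sinr L σ2 N lam ω ≤ L 0 / c * net.servingPower N ω := by
  rw [sinr_eq, div_mul_eq_mul_div]
  have h1 := hL.le_zero _ (servingDist_nonneg (net := net) lam ω)
  have h2 := servingPower_nonneg (net := net) N ω
  have h3 := hL.pos
  gcongr

/-- The ratio of the area spectral efficiency to its asymptotic equivalent. -/
def aseRatio (net : Network Ω) (L : ℝ → ℝ) (σ2 κ : ℝ) (N : ℕ) (lam : ℝ) (ω : Ω) : ℝ :=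
  Real.log (1 + net.sinr L σ2 N lam ω) / Real.log (1 + κ * (N / lam))

theorem ase_div_eq_aseRatio {κ lam : ℝ} (hlam : 0 < lam) (ω : Ω) :
    net.ase L σ2 Nt lam ω / (lam * Real.logb 2 (1 + κ * (Nt lam / lam)))
      = net.aseRatio L σ2 κ (Nt lam) lam ω := by
  rw [ase, mul_div_mul_left _ _ hlam.ne', Real.logb, Real.logb,
    div_div_div_cancel_right₀ (Real.log_pos one_lt_two).ne', aseRatio]

variable [MeasurableSpace Ω] {P : Measure Ω}

theorem HasModelLaw.measurable_aseRatio (hnet : net.HasModelLaw P) (hL : PhysicallyFeasible L)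
    (κ : ℝ) (N : ℕ) (lam : ℝ) : Measurable (net.aseRatio L σ2 κ N lam) :=
  ((hnet.measurable_sinr hL σ2 N lam).const_add 1).log.div_const _

theorem HasModelLaw.integrable_ase (hnet : net.HasModelLaw P) (hL : PhysicallyFeasible L)
    (hσ2 : 0 < σ2) (Nt : ℝ → ℕ) {lam : ℝ} (hlam : 0 < lam) :
    Integrable (fun ω => net.ase L σ2 Nt lam ω) P := by
  have hlog2 : 0 < Real.log 2 := Real.log_pos one_lt_two
  have hmeas : Measurable fun ω => net.ase L σ2 Nt lam ω :=
    ((((hnet.measurable_sinr hL σ2 (Nt lam) lam).const_add 1).log).div_const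
      (Real.log 2)).const_mul lam
  refine ((hnet.integrable_servingPower (Nt lam)).const_mul
    (lam * (L 0 / σ2 / Real.log 2))).mono' hmeas.aestronglyMeasurable (ae_of_all _ fun ω => ?_)
  have h0 := sinr_nonneg (net := net) hL hσ2 (Nt lam) lam ω
  have h1 := sinr_le (net := net) (σ2 := σ2) (N := Nt lam) (lam := lam) (ω := ω) hL hσ2
    (by linarith [interference_nonneg (net := net) hL (Nt lam) lam ω])
  have h2 := Real.log_le_sub_one_of_pos (x := 1 + net.sinr L σ2 (Nt lam) lam ω) (by linarith)
  have h3 : 0 ≤ Real.log (1 + net.sinr L σ2 (Nt lam) lam ω) := Real.log_nonneg (by linarith)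
  rw [ase, Real.logb, Real.norm_of_nonneg (mul_nonneg hlam.le (div_nonneg h3 hlog2.le)), mul_assoc]
  refine mul_le_mul_of_nonneg_left ?_ hlam.le
  rw [div_mul_eq_mul_div, div_le_div_iff_of_pos_right hlog2]
  linarith

variable [IsProbabilityMeasure P]

/-- Almost surely, the area spectral efficiency is asymptotically equivalent to
`lam * log₂ (1 + κ Nt / lam)`. -/
theorem HasModelLaw.ae_tendsto_aseRatio (hnet : net.HasModelLaw P) (hL : PhysicallyFeasible L)
    (hL0 : Tendsto L (𝓝[>] 0) (𝓝 (L 0))) (hσ2 : 0 < σ2) (hNt : Tendsto Nt atTop atTop) :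
    ∀ᵐ ω ∂P, Tendsto (fun lam => net.aseRatio L σ2 (L 0 / (2 * Real.pi * pathLossIntegral L))
      (Nt lam) lam ω) atTop (𝓝 1) := by
  have hM : 0 < 2 * Real.pi * pathLossIntegral L :=
    mul_pos Real.two_pi_pos hL.pathLossIntegral_pos
  have hcont : Tendsto L (𝓝[≥] 0) (𝓝 (L 0)) := continuousWithinAt_Ioi_iff_Ici.1 hL0
  have hI : ∀ᵐ ω ∂P, ∀ k : ℕ, ∃ K : ℝ, 0 < K ∧ ∀ᶠ lam : ℝ in atTop, ∀ N : ℕ, 1 ≤ N →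
      net.interference L N lam ω ≤ lam * (2 * Real.pi * pathLossIntegral L + 1 / ((k : ℝ) + 1))
        + K * Real.log N ∧
      lam * (2 * Real.pi * pathLossIntegral L - 1 / ((k : ℝ) + 1)) - K * Real.log N
        ≤ net.interference L N lam ω := by
    refine ae_all_iff.2 fun k => ?_
    obtain ⟨K, hK, h⟩ := hnet.ae_eventually_interference hL (ε := 1 / ((k : ℝ) + 1))
      (by positivity)
    exact h.mono fun ω hω => ⟨K, hK, hω⟩
  filter_upwards [hI, hnet.ae_tendsto_servingDist, hnet.ae_tendsto_servingPower]
    with ω hω hdist hpow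
  have hS : Tendsto (fun lam => L (net.servingDist lam ω) * net.servingPower (Nt lam) ω / Nt lam)
      atTop (𝓝 (L 0)) := by
    have h1 : Tendsto (fun lam => L (net.servingDist lam ω)) atTop (𝓝 (L 0)) :=
      hcont.comp (tendsto_nhdsWithin_iff.2
        ⟨hdist, Eventually.of_forall fun lam => servingDist_nonneg lam ω⟩)
    have h2 := h1.mul (hpow.comp hNt)
    rw [mul_one] at h2
    exact h2.congr fun lam => (mul_div_assoc _ _ _).symm
  have h := tendsto_log_one_add_sinr_ratio hNt hM hL.pos hσ2 hS
    (I := fun lam => net.interference L (Nt lam) lam ω)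
    (fun lam => interference_nonneg hL _ _ _) (fun ε hε => by
      obtain ⟨k, hk⟩ := exists_nat_one_div_lt hε
      obtain ⟨K, hK, hev⟩ := hω k
      refine ⟨K, hK, ?_⟩
      filter_upwards [hev, hNt.eventually_ge_atTop 1, eventually_ge_atTop 0]
        with lam h1 h2 h3
      obtain ⟨h4, h5⟩ := h1 (Nt lam) h2
      have h6 := mul_le_mul_of_nonneg_left hk.le h3
      constructor <;> linarith)
  refine h.congr fun lam => ?_
  rw [aseRatio, sinr_eq]

/-- The second moments of the ratio are bounded: the SINR is at most of the order `N / lam` unless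
the interference is much smaller than the density; on this event of exponentially small
probability, the noise still bounds the SINR. -/
theorem HasModelLaw.exists_integral_aseRatio_sq_le (hnet : net.HasModelLaw P)
    (hL : PhysicallyFeasible L) (hσ2 : 0 < σ2) {κ : ℝ} (hκ : 0 < κ) :
    ∃ C : ℝ, ∀ lam : ℝ, 0 < lam → ∀ N : ℕ, 1 ≤ N →
      Integrable (fun ω => net.aseRatio L σ2 κ N lam ω ^ 2) P ∧
      ∫ ω, net.aseRatio L σ2 κ N lam ω ^ 2 ∂P ≤ C := by
  obtain ⟨b, c, hb, hc, hbad⟩ := hnet.exists_measure_interference_lt_le hL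
  set m := ∫ z, (‖z‖ ^ 2) ^ 4 ∂complexGaussian with hm
  have hL0 := hL.pos
  set A := L 0 / b / κ with hA
  set A' := L 0 / σ2 / κ with hA'
  refine ⟨2 + 2 * A ^ 2 * (1 + m) + A' ^ 2 * (m + 72 / c ^ 4), fun lam hlam N hN => ?_⟩
  have hNpos : 0 < (N : ℝ) := by exact_mod_cast hN
  set T : Ω → ℝ := fun ω => net.servingPower N ω / N with hT
  obtain ⟨hTint, hTle⟩ : Integrable (fun ω => T ω ^ 4) P ∧ ∫ ω, T ω ^ 4 ∂P ≤ m :=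
    hnet.servingPower_pow_four hN
  set B : Set Ω := {ω | net.interference L N lam ω < b * lam} with hB
  have hBmeas : MeasurableSet B :=
    measurableSet_lt (hnet.measurable_interference hL N lam) measurable_const
  have hu : 0 < κ * (N / lam) := by positivity
  have hD : 0 < Real.log (1 + κ * (N / lam)) := Real.log_pos (by linarith)
  have hY0 : ∀ ω, 0 ≤ net.aseRatio L σ2 κ N lam ω := fun ω =>
    div_nonneg (Real.log_nonneg (by linarith [sinr_nonneg (net := net) hL hσ2 N lam ω])) hD.le
  have hY : ∀ ω, net.aseRatio L σ2 κ N lam ω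
      ≤ 1 + net.sinr L σ2 N lam ω / (κ * (N / lam)) := by
    intro ω
    have hx : 0 ≤ net.sinr L σ2 N lam ω / (κ * (N / lam)) :=
      div_nonneg (sinr_nonneg hL hσ2 _ _ _) hu.le
    have h1 := log_one_add_mul_le hu.le hx
    rw [mul_div_cancel₀ _ hu.ne', ← div_le_iff₀ hD] at h1
    exact h1.trans (max_le (by linarith) (by linarith))
  have hgood : ∀ ω ∉ B, net.sinr L σ2 N lam ω / (κ * (N / lam)) ≤ A * T ω := by
    intro ω hω
    have h1 : b * lam ≤ net.interference L N lam ω := not_lt.1 hω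
    rw [div_le_iff₀ hu]
    refine (sinr_le hL (c := b * lam) (by positivity) (by linarith)).trans (le_of_eq ?_)
    rw [hA, hT]
    field_simp
  have hnoise : ∀ ω, net.sinr L σ2 N lam ω / (κ * (N / lam)) ≤ A' * (lam * T ω) := by
    intro ω
    rw [div_le_iff₀ hu]
    refine (sinr_le hL hσ2 (by linarith [interference_nonneg (net := net) hL N lam ω])).trans
      (le_of_eq ?_)
    rw [hA', hT]
    field_simp
  have hbound : ∀ ω, net.aseRatio L σ2 κ N lam ω ^ 2 ≤ 2 + 2 * A ^ 2 * (1 + T ω ^ 4)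
      + A' ^ 2 * (T ω ^ 4 + B.indicator (fun _ => lam ^ 4) ω) := by
    intro ω
    have h1 : 0 ≤ net.sinr L σ2 N lam ω / (κ * (N / lam)) :=
      div_nonneg (sinr_nonneg hL hσ2 _ _ _) hu.le
    have h2 : net.aseRatio L σ2 κ N lam ω ^ 2
        ≤ 2 + 2 * (net.sinr L σ2 N lam ω / (κ * (N / lam))) ^ 2 := by
      have := pow_le_pow_left₀ (hY0 ω) (hY ω) 2
      nlinarith [sq_nonneg (1 - net.sinr L σ2 N lam ω / (κ * (N / lam)))]
    have h4 : 0 ≤ A ^ 2 * (1 + T ω ^ 4) := by positivity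
    have h5 : 0 ≤ A' ^ 2 * T ω ^ 4 := by positivity
    by_cases hω : ω ∈ B
    · rw [Set.indicator_of_mem hω]
      have h3 := pow_le_pow_left₀ h1 (hnoise ω) 2
      have h6 : 2 * (lam * T ω) ^ 2 ≤ T ω ^ 4 + lam ^ 4 := by
        nlinarith [sq_nonneg (T ω ^ 2 - lam ^ 2)]
      have h7 := mul_le_mul_of_nonneg_left h6 (sq_nonneg A')
      nlinarith
    · rw [Set.indicator_of_notMem hω]
      have h3 := pow_le_pow_left₀ h1 (hgood ω hω) 2
      have h6 : T ω ^ 2 ≤ 1 + T ω ^ 4 := by nlinarith [sq_nonneg (T ω ^ 2 - 1)]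
      have h7 := mul_le_mul_of_nonneg_left h6 (sq_nonneg A)
      nlinarith
  have hIB : Integrable (B.indicator fun _ => lam ^ 4) P :=
    (integrable_const (lam ^ 4)).indicator hBmeas
  have hI0 : Integrable (fun ω => 2 * A ^ 2 * (1 + T ω ^ 4)) P :=
    ((integrable_const 1).add hTint).const_mul _
  have hI1 : Integrable (fun ω => 2 + 2 * A ^ 2 * (1 + T ω ^ 4)) P :=
    (integrable_const 2).add hI0
  have hI2 : Integrable (fun ω => A' ^ 2 * (T ω ^ 4 + B.indicator (fun _ => lam ^ 4) ω)) P :=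
    (hTint.add hIB).const_mul _
  have hint : Integrable (fun ω => net.aseRatio L σ2 κ N lam ω ^ 2) P := by
    refine (hI1.add hI2).mono'
      ((hnet.measurable_aseRatio hL κ N lam).pow_const 2).aestronglyMeasurable
      (ae_of_all _ fun ω => ?_)
    rw [Real.norm_of_nonneg (sq_nonneg _)]
    exact hbound ω
  refine ⟨hint, (integral_mono hint (hI1.add hI2) hbound).trans ?_⟩
  have hPB : lam ^ 4 * P.real B ≤ 72 / c ^ 4 := by
    have h1 : P.real B ≤ 3 * Real.exp (-(c * lam)) :=
      ENNReal.toReal_le_of_le_ofReal (by positivity) (hbad lam hlam N hN)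
    have h2 := Real.pow_div_factorial_le_exp (c * lam) (by positivity) 4
    have h3 : lam ^ 4 ≤ 24 / c ^ 4 * Real.exp (c * lam) := by
      rw [div_le_iff₀ (by positivity)] at h2
      rw [div_mul_eq_mul_div, le_div_iff₀ (by positivity)]
      have : (Nat.factorial 4 : ℝ) = 24 := by norm_num [Nat.factorial]
      rw [this] at h2
      linarith [mul_pow c lam 4]
    calc lam ^ 4 * P.real B
        ≤ 24 / c ^ 4 * Real.exp (c * lam) * (3 * Real.exp (-(c * lam))) := by gcongr
      _ = 72 / c ^ 4 * (Real.exp (c * lam) * Real.exp (-(c * lam))) := by ring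
      _ = 72 / c ^ 4 := by rw [← Real.exp_add, add_neg_cancel, Real.exp_zero, mul_one]
  rw [Pi.add_def, integral_add hI1 hI2, integral_add (integrable_const 2) hI0,
    integral_const_mul, integral_const_mul,
    integral_add (integrable_const 1) hTint, integral_add hTint hIB,
    integral_indicator_const _ hBmeas]
  simp only [integral_const, probReal_univ, smul_eq_mul, one_mul, mul_comm (P.real B)]
  gcongr

/-- The mean of the area spectral efficiency is asymptotically equivalent to
`lam * log₂ (1 + κ Nt / lam)`. -/
theorem HasModelLaw.tendsto_integral_aseRatio (hnet : net.HasModelLaw P)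
    (hL : PhysicallyFeasible L) (hL0 : Tendsto L (𝓝[>] 0) (𝓝 (L 0))) (hσ2 : 0 < σ2)
    (hNt : Tendsto Nt atTop atTop) :
    Tendsto (fun lam => ∫ ω, net.aseRatio L σ2 (L 0 / (2 * Real.pi * pathLossIntegral L))
      (Nt lam) lam ω ∂P) atTop (𝓝 1) := by
  have hκ : 0 < L 0 / (2 * Real.pi * pathLossIntegral L) :=
    div_pos hL.pos (mul_pos Real.two_pi_pos hL.pathLossIntegral_pos)
  obtain ⟨C, hC⟩ := hnet.exists_integral_aseRatio_sq_le hL hσ2 hκ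
  refine tendsto_integral_of_sq_le (C := C) (fun lam => hnet.measurable_aseRatio hL _ _ _) ?_
    (hnet.ae_tendsto_aseRatio hL hL0 hσ2 hNt)
  filter_upwards [eventually_gt_atTop 0, hNt.eventually_ge_atTop 1] with lam h1 h2
  exact hC lam h1 (Nt lam) h2

end Network

end

theorem theorem2 {Ω : Type*} [MeasurableSpace Ω] (P : Measure Ω) [IsProbabilityMeasure P]
    (net : Network Ω) (hnet : net.HasModelLaw P)
    (L : ℝ → ℝ) (hL : PhysicallyFeasible L) (hL0 : Tendsto L (𝓝[>] 0) (𝓝 (L 0)))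
    (σ2 : ℝ) (hσ2 : 0 < σ2)
    (Nt : ℝ → ℕ) (hmono : MonotoneOn Nt (Set.Ioi 0)) (hNt : Tendsto Nt atTop atTop) :
    (∀ᵐ ω ∂P, HasScalingLaws Nt (L 0 / (2 * Real.pi * pathLossIntegral L))
      (fun lam => net.ase L σ2 Nt lam ω)) ∧
    (TailAssumption L →
      (∀ lam : ℝ, 0 < lam → Integrable (fun ω => net.ase L σ2 Nt lam ω) P) ∧
      HasScalingLaws Nt (L 0 / (2 * Real.pi * pathLossIntegral L))
        (fun lam => ∫ ω, net.ase L σ2 Nt lam ω ∂P)) := by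
  have hκ : 0 < L 0 / (2 * Real.pi * pathLossIntegral L) :=
    div_pos hL.pos (mul_pos Real.two_pi_pos hL.pathLossIntegral_pos)
  refine ⟨?_, fun _ => ⟨fun lam hlam => hnet.integrable_ase hL hσ2 Nt hlam, ?_⟩⟩
  · filter_upwards [hnet.ae_tendsto_aseRatio hL hL0 hσ2 hNt] with ω hω
    refine hasScalingLaws_of_tendsto hκ hNt (hω.congr' ?_)
    filter_upwards [eventually_gt_atTop 0] with lam hlam
    exact (Network.ase_div_eq_aseRatio hlam ω).symm
  · refine hasScalingLaws_of_tendsto hκ hNt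
      ((hnet.tendsto_integral_aseRatio hL hL0 hσ2 hNt).congr' ?_)
    filter_upwards [eventually_gt_atTop 0] with lam hlam
    rw [← integral_div]
    exact integral_congr_ae (ae_of_all _ fun ω => (Network.ase_div_eq_aseRatio hlam ω).symm)
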